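/- **Setting.** Let $n\in\mathbb N$, $n\ge 1$, $0<s<1$, and let $\Omega\subseteq\mathbb R^n$ be a bounded open set (in particular, $\Omega$ may be a bounded Lipschitz open set). All functions are real-valued, and $(-\Delta)^{s/2}$ is defined by Fourier transform. Let $H^s(\mathbb R^n)=\{u\in L^2(\mathbb R^n):(-\Delta)^{s/2}u\in L^2(\mathbb R^n)\}$ with the scalar product $(u,v)_{H^s}=\int_{\mathbb R^n}\big((-\Delta)^{s/2}u\,(-\Delta)^{s/2}v+uv\big)\,dx$, let $H_0^s(\Omega)$ be the closure of $C_c^\infty(\Omega)$ in $H^s(\mathbb R^n)$, let $H(\Omega_e)=H^s(\mathbb R^n)/H_0^s(\Omega)$ be the quotient Hilbert space, and write $u|_{\Omega_e}$ for the class of $u\in H^s(\mathbb R^n)$ in $H(\Omega_e)$. For $q\in L^\infty(\Omega)$ put $$\mathscr B_q(u,w)=\int_{\mathbb R^n}(-\Delta)^{s/2}u\,(-\Delta)^{s/2}w\,dx+\int_\Omega quw\,dx ,\qquad u,w\in H^s(\mathbb R^n).$$ For $f\in L^2(\Omega)$, a function $u\in H^s(\mathbb R^n)$ solves $(-\Delta)^su+qu=f$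 in $\Omega$ if $\mathscr B_q(u,w)=\int_\Omega fw\,dx$ for all $w\in H_0^s(\Omega)$. Let - $N_q=\{u\in H_0^s(\Omega):(-\Delta)^su+qu=0\text{ in }\Omega\}$, and let $H^s_q(\mathbb R^n)$ be the orthogonal complement of $N_q$ in $H^s(\mathbb R^n)$; - $H_q(\Omega_e)=\{F\in H(\Omega_e):\mathscr B_q(u,w)=0\text{ for all }w\in N_q\}$, where $u\in H^s(\mathbb R^n)$ is any function with $u|_{\Omega_e}=F$, and $H_{q_1,q_2}(\Omega_e)=H_{q_1}(\Omega_e)\cap H_{q_2}(\Omega_e)$; - $\Lambda(q):H_q(\Omega_e)\to H(\Omega_e)^*$ be the Dirichlet-to-Neumann operator, which maps $F$ to the functional $v|_{\Omega_e}\mapsto\int_{\mathbb R^n}(-\Delta)^{s/2}u\,(-\Delta)^{s/2}v\,dx+\int_\Omega quv\,dx$, where $u\in H_q^s(\mathbb R^n)$ solves $(-\Delta)^su+qu=0$ in $\Omega$, $u|_{\Omega_e}=F$ (this functional is the Neumann trace of $u$, since $(-\Delta)^su=-qu$ in $\Omega$); - $d(q)\in\mathbb N_0$ be the number of eigenvalues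 greater than $1$, counted with multiplicity, of the compact self-adjoint operator $\iota^*\iota-\iota^*M_q\iota$ on $H_0^s(\Omega)$, where $\iota:H_0^s(\Omega)\to L^2(\Omega)$ is the restriction and embedding and $M_q$ is the multiplication by $q$ on $L^2(\Omega)$. For operators $L_j:H_j\to H^*$ ($j=1,2$) on subspaces $H_1,H_2$ of a Hilbert space $H$, and $d\in\mathbb N_0$, write $L_1\ge_d L_2$ if there is a subspace $W\subseteq H_1\cap H_2$ with $\dim W\le d$ and $\langle(L_1-L_2)v,v\rangle\ge0$ for all $v\in W^\perp$. Here and below, orthogonal complements of subspaces of $H_1\cap H_2$, and of $H_{q_1,q_2}(\Omega_e)$, are taken within these spaces. **Theorem (Monotonicity relations).** Let $q_1,q_2\in L^\infty(\Omega)$. 1. For $j=1,2$ and every $F\in H_{q_j}(\Omega_e)$ there is exactly one $u\in H^s_{q_j}(\mathbb R^n)$ with $(-\Delta)^su+q_ju=0$ in $\Omega$ and $u|_{\Omega_e}=F$; thus $\Lambda(q_1)$ and $\Lambda(q_2)$ are well defined. 2. There is a subspace $V\subseteq H_{q_1,q_2}(\Omega_e)$ with $\dim V\le d(q_2)$ such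 that $$\langle(\Lambda(q_1)-\Lambda(q_2))F,F\rangle\ \ge\ \int_\Omega(q_1-q_2)|u_1|^2\,dx\qquad\text{for all }F\in V^\perp\subseteq H_{q_1,q_2}(\Omega_e),$$ where $u_1\in H^s_{q_1}(\mathbb R^n)$ solves $(-\Delta)^su_1+q_1u_1=0$ in $\Omega$ with $u_1|_{\Omega_e}=F$. 3. If $q_1\ge q_2$ a.e. in $\Omega$, then $\Lambda(q_1)\ge_{d(q_2)}\Lambda(q_2)$. -/

import Mathlib

open MeasureTheory FourierTransform Filter
open scoped ENNReal InnerProductSpace ContDiff Topology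

noncomputable section

namespace FracSchrodinger

/-- Euclidean space `ℝⁿ`. -/
abbrev Eucl (n : ℕ) : Type := EuclideanSpace ℝ (Fin n)

/-- The real-valued space `L²(ℝⁿ)`. -/
abbrev L2 (n : ℕ) : Type := Lp ℝ 2 (volume : Measure (Eucl n))

/-- The real-valued space `L²(Ω)`. -/
abbrev L2On {n : ℕ} (Ω : Set (Eucl n)) : Type := Lp ℝ 2 ((volume : Measure (Eucl n)).restrict Ω)

/-- The real-valued space `L^∞(Ω)`. -/
abbrev LInftyOn {n : ℕ} (Ω : Set (Eucl n)) : Type :=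
  Lp ℝ ∞ ((volume : Measure (Eucl n)).restrict Ω)

/-- A real-valued `L²` function regarded as a complex-valued one. -/
def complexify (n : ℕ) : L2 n →L[ℝ] Lp ℂ 2 (volume : Measure (Eucl n)) :=
  Complex.ofRealCLM.compLpL 2 volume

/-- `IsHalfFracLaplacian s u g` says that `(-Δ)^(s/2) u = g`, for `u, g ∈ L²(ℝⁿ)`, where
`(-Δ)^(s/2)` is defined by Fourier transform. Its symbol is `|ξ|^s` for the Fourier transform with
kernel `exp (-i x·ξ)`, hence `(2π|ξ|)^s` for the kernel `exp (-2πi x·ξ)` used here. -/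
def IsHalfFracLaplacian {n : ℕ} (s : ℝ) (u g : L2 n) : Prop :=
  ∀ᵐ ξ : Eucl n, (𝓕 (complexify n g)) ξ =
    (((2 * Real.pi * ‖ξ‖) ^ s : ℝ) : ℂ) * (𝓕 (complexify n u)) ξ

/-- The fractional Sobolev space `H^s(ℝⁿ) = {u ∈ L² : (-Δ)^(s/2) u ∈ L²}` with the scalar product
`∫ ((-Δ)^(s/2) u * (-Δ)^(s/2) v + u * v)`. It is realized as the graph of `(-Δ)^(s/2)`, that is, as
the space of pairs `(u, (-Δ)^(s/2) u)` in the Hilbert space `L² × L²`; the second component is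
determined by the first one. -/
def Hs (n : ℕ) (s : ℝ) : Submodule ℝ (WithLp 2 (L2 n × L2 n)) where
  carrier := {p | IsHalfFracLaplacian s p.fst p.snd}
  add_mem' := by
    intro p q hp hq
    simp only [Set.mem_ofPred_eq, IsHalfFracLaplacian, WithLp.add_fst, WithLp.add_snd, map_add,
      FourierTransform.fourier_add] at hp hq ⊢
    filter_upwards [hp, hq, Lp.coeFn_add (𝓕 (complexify n p.fst)) (𝓕 (complexify n q.fst)),
      Lp.coeFn_add (𝓕 (complexify n p.snd)) (𝓕 (complexify n q.snd))] with ξ h1 h2 h3 h4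
    rw [h3, h4, Pi.add_apply, Pi.add_apply, h1, h2, mul_add]
  zero_mem' := by
    simp only [Set.mem_ofPred_eq, IsHalfFracLaplacian, WithLp.zero_fst, WithLp.zero_snd, map_zero,
      FourierTransform.fourier_zero]
    filter_upwards [Lp.coeFn_zero ℂ 2 (volume : Measure (Eucl n))] with ξ h
    rw [h]; simp
  smul_mem' := by
    intro c p hp
    have key : ∀ f : Lp ℂ 2 (volume : Measure (Eucl n)), 𝓕 (c • f) = c • 𝓕 f := fun f => by
      rw [← algebraMap_smul ℂ c f, FourierTransform.fourier_smul, algebraMap_smul]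
    simp only [Set.mem_ofPred_eq, IsHalfFracLaplacian, WithLp.smul_fst, WithLp.smul_snd, map_smul,
      key] at hp ⊢
    filter_upwards [hp, Lp.coeFn_smul c (𝓕 (complexify n p.fst)),
      Lp.coeFn_smul c (𝓕 (complexify n p.snd))] with ξ h1 h3 h4
    rw [h3, h4, Pi.smul_apply, Pi.smul_apply, h1, mul_smul_comm]

theorem isClosed_Hs (n : ℕ) (s : ℝ) : IsClosed (Hs n s : Set (WithLp 2 (L2 n × L2 n))) := by
  refine IsSeqClosed.isClosed fun x p hx hxp => ?_
  have hF : ∀ g : ℕ → L2 n, ∀ a : L2 n, Tendsto g atTop (𝓝 a) →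
      Tendsto (fun k => 𝓕 (complexify n (g k))) atTop (𝓝 (𝓕 (complexify n a))) := fun g a h =>
    (((Lp.fourierTransformₗᵢ (Eucl n) ℂ).continuous.comp (complexify n).continuous).tendsto a).comp
      h
  have h1 := hF _ _ (((WithLp.fstL 2 ℝ (L2 n) (L2 n)).continuous.tendsto p).comp hxp)
  have h2 := hF _ _ (((WithLp.sndL 2 ℝ (L2 n) (L2 n)).continuous.tendsto p).comp hxp)
  obtain ⟨φ, hφ, hφ'⟩ := (tendstoInMeasure_of_tendsto_Lp h1).exists_seq_tendsto_ae
  obtain ⟨ψ, hψ, hψ'⟩ := (tendstoInMeasure_of_tendsto_Lp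
    (h2.comp hφ.tendsto_atTop)).exists_seq_tendsto_ae
  have hall : ∀ᵐ ξ : Eucl n, ∀ k, (𝓕 (complexify n (x k).snd)) ξ =
      (((2 * Real.pi * ‖ξ‖) ^ s : ℝ) : ℂ) * (𝓕 (complexify n (x k).fst)) ξ :=
    ae_all_iff.2 fun k => hx k
  change IsHalfFracLaplacian s p.fst p.snd
  filter_upwards [hφ', hψ', hall] with ξ a1 a2 a3
  refine tendsto_nhds_unique a2 ?_
  refine ((a1.comp hψ.tendsto_atTop).const_mul
    (((2 * Real.pi * ‖ξ‖) ^ s : ℝ) : ℂ)).congr fun k => ?_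
  exact (a3 _).symm

instance instCompleteSpaceHs (n : ℕ) (s : ℝ) : CompleteSpace (Hs n s) :=
  (isClosed_Hs n s).completeSpace_coe

section

variable {n : ℕ} {s : ℝ}

/-- The function `u ∈ L²(ℝⁿ)` underlying an element of `H^s(ℝⁿ)`. -/
def toL2 : Hs n s →L[ℝ] L2 n :=
  (WithLp.fstL 2 ℝ (L2 n) (L2 n)).comp (Hs n s).subtypeL

/-- The operator `(-Δ)^(s/2) : H^s(ℝⁿ) → L²(ℝⁿ)`. -/
def halfFracLaplacian : Hs n s →L[ℝ] L2 n :=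
  (WithLp.sndL 2 ℝ (L2 n) (L2 n)).comp (Hs n s).subtypeL

/-- The restriction `u ↦ u|_Ω` from `H^s(ℝⁿ)` to `L²(Ω)`. -/
def restrictL2 (Ω : Set (Eucl n)) : Hs n s →L[ℝ] L2On Ω :=
  (LpToLpRestrictCLM (Eucl n) ℝ ℝ volume 2 Ω).comp toL2

/-- Multiplication by `q ∈ L^∞(Ω)` as a bounded operator on `L²(Ω)`. -/
def mulOp {Ω : Set (Eucl n)} (q : LInftyOn Ω) : L2On Ω →L[ℝ] L2On Ω :=
  (ContinuousLinearMap.mul ℝ ℝ).holderL (volume.restrict Ω) ∞ 2 2 q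

variable (n s) in
/-- The elements of `H^s(ℝⁿ)` given by functions in `C_c^∞(Ω)`. -/
def testFunctions (Ω : Set (Eucl n)) : Submodule ℝ (Hs n s) where
  carrier := {u | ∃ φ : Eucl n → ℝ, ContDiff ℝ ∞ φ ∧ HasCompactSupport φ ∧ tsupport φ ⊆ Ω ∧
    toL2 u =ᵐ[volume] φ}
  add_mem' := by
    rintro u v ⟨φ, h1, h2, h3, h4⟩ ⟨ψ, k1, k2, k3, k4⟩
    refine ⟨φ + ψ, h1.add k1, h2.add k2, ?_, ?_⟩
    · exact (tsupport_add φ ψ).trans (Set.union_subset h3 k3)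
    · rw [map_add]
      exact (Lp.coeFn_add _ _).trans (h4.add k4)
  zero_mem' := by
    refine ⟨0, contDiff_const, HasCompactSupport.zero, by simp, ?_⟩
    rw [map_zero]
    exact Lp.coeFn_zero _ _ _
  smul_mem' := by
    rintro c u ⟨φ, h1, h2, h3, h4⟩
    refine ⟨c • φ, h1.const_smul c, h2.smul_left (f := fun _ => c), ?_, ?_⟩
    · exact (tsupport_smul_subset_right (fun _ => c) φ).trans h3
    · rw [map_smul]
      exact (Lp.coeFn_smul _ _).trans (h4.const_smul c)

variable (n s) in
/-- `H₀^s(Ω)`, the closure of `C_c^∞(Ω)` in `H^s(ℝⁿ)`. -/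
def H0s (Ω : Set (Eucl n)) : Submodule ℝ (Hs n s) :=
  (testFunctions n s Ω).topologicalClosure

instance instCompleteSpaceH0s (Ω : Set (Eucl n)) : CompleteSpace (H0s n s Ω) :=
  (testFunctions n s Ω).isClosed_topologicalClosure.completeSpace_coe

instance instIsClosedH0s (Ω : Set (Eucl n)) : IsClosed (H0s n s Ω : Set (Hs n s)) :=
  (testFunctions n s Ω).isClosed_topologicalClosure

variable (n s) in
/-- The space `H(Ω_e) = H^s(ℝⁿ) / H₀^s(Ω)` of Dirichlet traces, with its quotient Hilbert space
structure. -/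
def TraceSpace (Ω : Set (Eucl n)) : Type := Hs n s ⧸ H0s n s Ω

instance instNormedAddCommGroupTraceSpace (Ω : Set (Eucl n)) :
    NormedAddCommGroup (TraceSpace n s Ω) :=
  inferInstanceAs (NormedAddCommGroup (Hs n s ⧸ H0s n s Ω))

instance instInnerProductSpaceTraceSpace (Ω : Set (Eucl n)) :
    InnerProductSpace ℝ (TraceSpace n s Ω) :=
  inferInstanceAs (InnerProductSpace ℝ (Hs n s ⧸ H0s n s Ω))

instance instCompleteSpaceTraceSpace (Ω : Set (Eucl n)) : CompleteSpace (TraceSpace n s Ω) :=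
  inferInstanceAs (CompleteSpace (Hs n s ⧸ H0s n s Ω))

/-- The Dirichlet trace operator `u ↦ u|_{Ω_e} = u + H₀^s(Ω)`. -/
def trace (Ω : Set (Eucl n)) : Hs n s →ₗ[ℝ] TraceSpace n s Ω := (H0s n s Ω).mkQ

variable {Ω : Set (Eucl n)}

/-- The bilinear form
`B_q(u, w) = ∫_{ℝⁿ} (-Δ)^(s/2) u * (-Δ)^(s/2) w + ∫_Ω q u w` on `H^s(ℝⁿ)`. -/
def form (q : LInftyOn Ω) (u w : Hs n s) : ℝ :=
  (∫ x, halfFracLaplacian u x * halfFracLaplacian w x) + ∫ x in Ω, q x * toL2 u x * toL2 w x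

/-- `u ∈ H^s(ℝⁿ)` solves `(-Δ)^s u + q u = f` in `Ω` (weakly, in the variational formulation). -/
def Solves (q : LInftyOn Ω) (f : L2On Ω) (u : Hs n s) : Prop :=
  ∀ w ∈ H0s n s Ω, form q u w = ∫ x in Ω, f x * toL2 w x

theorem real_inner_mul (a b : ℝ) : ⟪a, b⟫_ℝ = a * b := by simp [mul_comm]

theorem restrictL2_ae (u : Hs n s) : restrictL2 Ω u =ᵐ[volume.restrict Ω] toL2 u :=
  LpToLpRestrictCLM_coeFn ℝ Ω (toL2 u)

theorem mulOp_ae (q : LInftyOn Ω) (f : L2On Ω) :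
    mulOp q f =ᵐ[volume.restrict Ω] fun x => q x * f x :=
  (ContinuousLinearMap.mul ℝ ℝ).coeFn_holder q f

theorem integral_eq_inner (f : L2On Ω) (w : Hs n s) :
    ∫ x in Ω, f x * toL2 w x = ⟪f, restrictL2 Ω w⟫_ℝ := by
  rw [L2.inner_def]
  refine integral_congr_ae ?_
  filter_upwards [restrictL2_ae (Ω := Ω) w] with x hx
  rw [hx, real_inner_mul]

theorem form_eq_inner (q : LInftyOn Ω) (u w : Hs n s) :
    form q u w = ⟪halfFracLaplacian u, halfFracLaplacian w⟫_ℝ +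
      ⟪mulOp q (restrictL2 Ω u), restrictL2 Ω w⟫_ℝ := by
  rw [← integral_eq_inner, L2.inner_def, form]
  congr 1
  · exact integral_congr_ae (Eventually.of_forall fun x => (real_inner_mul _ _).symm)
  · refine integral_congr_ae ?_
    filter_upwards [mulOp_ae q (restrictL2 Ω u), restrictL2_ae (Ω := Ω) u] with x h1 h2
    rw [h1, h2]

theorem form_comm (q : LInftyOn Ω) (u w : Hs n s) : form q u w = form q w u := by
  unfold form
  congr 1
  · exact integral_congr_ae (Eventually.of_forall fun x => mul_comm _ _)
  · exact integral_congr_ae (Eventually.of_forall fun x => by ring)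

/-- `N_q`, the space of all `u ∈ H₀^s(Ω)` with `(-Δ)^s u + q u = 0` in `Ω`. -/
def homSolutions (s : ℝ) (q : LInftyOn Ω) : Submodule ℝ (Hs n s) where
  carrier := {u | u ∈ H0s n s Ω ∧ Solves q 0 u}
  add_mem' := by
    rintro u v ⟨h1, h2⟩ ⟨k1, k2⟩
    refine ⟨add_mem h1 k1, fun w hw => ?_⟩
    have a := h2 w hw
    have b := k2 w hw
    rw [integral_eq_inner, inner_zero_left, form_eq_inner] at a b ⊢
    simp only [map_add, inner_add_left]
    linarith
  zero_mem' := by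
    refine ⟨zero_mem _, fun w hw => ?_⟩
    rw [integral_eq_inner, form_eq_inner]
    simp
  smul_mem' := by
    rintro c u ⟨h1, h2⟩
    refine ⟨Submodule.smul_mem _ c h1, fun w hw => ?_⟩
    have a := h2 w hw
    rw [integral_eq_inner, inner_zero_left, form_eq_inner] at a ⊢
    simp only [map_smul, real_inner_smul_left]
    rw [← mul_add, a, mul_zero]

/-- `H_q^s(ℝⁿ)`, the orthogonal complement of `N_q` in `H^s(ℝⁿ)`. -/
def HsPerp (s : ℝ) (q : LInftyOn Ω) : Submodule ℝ (Hs n s) := (homSolutions s q)ᗮ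

/-- `H_q(Ω_e)`, the space of all `F ∈ H(Ω_e)` with `B_q(u, w) = 0` for all `w ∈ N_q`, where
`u ∈ H^s(ℝⁿ)` has the trace `F` (the choice of `u` does not matter). -/
def admissibleTraces (s : ℝ) (q : LInftyOn Ω) : Submodule ℝ (TraceSpace n s Ω) where
  carrier := {F | ∀ u : Hs n s, trace Ω u = F → ∀ w ∈ homSolutions s q, form q u w = 0}
  add_mem' := by
    intro F G hF hG u hu w hw
    obtain ⟨v, hv⟩ := (H0s n s Ω).mkQ_surjective F
    have a := hF v hv w hw
    have b := hG (u - v) (by rw [map_sub, hu]; exact sub_eq_of_eq_add' (by rw [← hv]; rfl)) w hw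
    rw [form_eq_inner] at a b ⊢
    simp only [map_sub, inner_sub_left] at b
    linarith
  zero_mem' := by
    intro u hu w hw
    have hu' : u ∈ H0s n s Ω := (Submodule.Quotient.mk_eq_zero _).1 hu
    have a := hw.2 u hu'
    rw [integral_eq_inner, inner_zero_left] at a
    rw [form_comm, a]
  smul_mem' := by
    intro c F hF u hu w hw
    obtain ⟨v, hv⟩ := (H0s n s Ω).mkQ_surjective F
    have a := hF v hv w hw
    have hz : u - c • v ∈ H0s n s Ω := by
      rw [← Submodule.Quotient.mk_eq_zero, Submodule.Quotient.mk_sub, Submodule.Quotient.mk_smul]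
      exact sub_eq_zero.2 (hu.trans (by rw [← hv]; rfl))
    have b := hw.2 _ hz
    rw [integral_eq_inner, inner_zero_left, form_comm, form_eq_inner] at b
    rw [form_eq_inner] at a ⊢
    simp only [map_sub, map_smul, inner_sub_left, real_inner_smul_left] at b
    linear_combination b + c * a

/-- `u ∈ H_q^s(ℝⁿ)` solves the Dirichlet problem `(-Δ)^s u + q u = 0` in `Ω`, `u|_{Ω_e} = F`. -/
def IsDirichletSolution (q : LInftyOn Ω) (F : TraceSpace n s Ω) (u : Hs n s) : Prop :=
  u ∈ HsPerp s q ∧ Solves q 0 u ∧ trace Ω u = F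

/-- The Neumann trace `(-Δ)^s u|_{Ω_e} ∈ H(Ω_e)^*` of a function `u ∈ H^s(ℝⁿ)` for which
`(-Δ)^s u = f` in `Ω` with `f ∈ L²(Ω)`. It maps the trace of `v ∈ H^s(ℝⁿ)` to
`∫_{ℝⁿ} (-Δ)^(s/2) u * (-Δ)^(s/2) v - ∫_Ω f v`. -/
def neumannTrace (u : Hs n s) (f : L2On Ω) (h : Solves 0 f u) :
    StrongDual ℝ (TraceSpace n s Ω) :=
  (H0s n s Ω).liftQL
    ((innerSL ℝ (halfFracLaplacian u)).comp halfFracLaplacian -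
      (innerSL ℝ f).comp (restrictL2 Ω)) (by
    intro w hw
    have a := h w hw
    rw [integral_eq_inner, form_eq_inner] at a
    simp only [mulOp, map_zero, zero_apply, inner_zero_left, add_zero] at a
    change ⟪halfFracLaplacian u, halfFracLaplacian w⟫_ℝ - ⟪f, restrictL2 Ω w⟫_ℝ = 0
    rw [a, sub_self])

/-- The defining formula of the Neumann trace. -/
theorem neumannTrace_trace (u : Hs n s) (f : L2On Ω) (h : Solves 0 f u) (v : Hs n s) :
    neumannTrace u f h (trace Ω v) =
      (∫ x, halfFracLaplacian u x * halfFracLaplacian v x) - ∫ x in Ω, f x * toL2 v x := by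
  rw [integral_eq_inner]
  have e : ∫ x, halfFracLaplacian u x * halfFracLaplacian v x =
      ⟪halfFracLaplacian u, halfFracLaplacian v⟫_ℝ := by
    rw [L2.inner_def]
    exact integral_congr_ae (Eventually.of_forall fun x => (real_inner_mul _ _).symm)
  rw [e]
  rfl

/-- A solution of `(-Δ)^s u + q u = 0` in `Ω` satisfies `(-Δ)^s u = -q u` in `Ω`. -/
theorem Solves.fracLaplacian_eq {q : LInftyOn Ω} {u : Hs n s} (h : Solves q 0 u) :
    Solves 0 (-mulOp q (restrictL2 Ω u)) u := by
  intro w hw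
  have a := h w hw
  rw [integral_eq_inner, form_eq_inner] at a ⊢
  simp only [inner_zero_left] at a
  rw [inner_neg_left, mulOp, map_zero, zero_apply, inner_zero_left]
  linarith

open Classical in
/-- The Dirichlet-to-Neumann operator `Λ(q) : H_q(Ω_e) → H(Ω_e)^*`, which maps `F` to the Neumann
trace `(-Δ)^s u|_{Ω_e}` of the solution `u ∈ H_q^s(ℝⁿ)` of `(-Δ)^s u + q u = 0` in `Ω`,
`u|_{Ω_e} = F`. (For a bounded open set `Ω`, this solution exists and is unique.) -/
def dtn (s : ℝ) (q : LInftyOn Ω) (F : admissibleTraces s q) : StrongDual ℝ (TraceSpace n s Ω) :=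
  if h : ∃ u : Hs n s, IsDirichletSolution q (F : TraceSpace n s Ω) u then
    neumannTrace h.choose (-mulOp q (restrictL2 Ω h.choose)) h.choose_spec.2.1.fracLaplacian_eq
  else 0

/-- The restriction and embedding `ι : H₀^s(Ω) → L²(Ω)`. -/
def embed (s : ℝ) (Ω : Set (Eucl n)) : H0s n s Ω →L[ℝ] L2On Ω :=
  (restrictL2 Ω).comp (H0s n s Ω).subtypeL

/-- The operator `ι^* ι - ι^* M_q ι` on `H₀^s(Ω)`. -/
def compactPart (s : ℝ) (q : LInftyOn Ω) : H0s n s Ω →L[ℝ] H0s n s Ω :=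
  (ContinuousLinearMap.adjoint (E := H0s n s Ω) (F := L2On Ω) (embed s Ω)).comp (embed s Ω) -
    (ContinuousLinearMap.adjoint (E := H0s n s Ω) (F := L2On Ω) (embed s Ω)).comp
      ((mulOp q).comp (embed s Ω))

/-- `d(q)`, the number of eigenvalues of `ι^* ι - ι^* M_q ι` that are greater than `1`, counted
with multiplicity. -/
def numEigenvalues (s : ℝ) (q : LInftyOn Ω) : ℕ :=
  ∑ᶠ (μ : ℝ) (_ : 1 < μ), Module.finrank ℝ
    (Module.End.eigenspace (compactPart s q : H0s n s Ω →ₗ[ℝ] H0s n s Ω) μ)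

end

/-- The extended Loewner order `L₁ ≤_d L₂` for operators `L₁ : H₁ → H^*`, `L₂ : H₂ → H^*` that are
defined on subspaces of a Hilbert space `H`: there is a subspace `W` of `H₁ ∩ H₂` with
`dim W ≤ d` so that `⟨(L₂ - L₁) v, v⟩ ≥ 0` for all `v` in the orthogonal complement of `W` in
`H₁ ∩ H₂`. -/
def LoewnerLE {H : Type*} [NormedAddCommGroup H] [InnerProductSpace ℝ H] (d : ℕ)
    {H₁ H₂ : Submodule ℝ H} (L₁ : H₁ → StrongDual ℝ H) (L₂ : H₂ → StrongDual ℝ H) : Prop :=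
  ∃ W : Submodule ℝ ↥(H₁ ⊓ H₂), Module.rank ℝ W ≤ d ∧
    ∀ v ∈ Wᗮ, 0 ≤ (L₂ ⟨v, v.2.2⟩ - L₁ ⟨v, v.2.1⟩) (v : H)

end FracSchrodinger

end

/-! Functions in `H0s` vanish outside `Ω`, so there the `L²(ℝⁿ)` part of the scalar product is
`ι^*ι`. Hence `B_q(u, w) = ⟪(1 - T) u, w⟫` on `H0s`, where `T` is `compactPart s q`
(`form_eq_inner_sub_compactPart`). `T` is symmetric, and it is compact by Rellich's theorem
(`isCompactOperator_embed`).

Well-posedness is the Fredholm alternative for `1 - T`. Its kernel is `N_q`, and the solvability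
condition is exactly admissibility of the trace. Uniqueness holds because two solutions in `H_q^s`
differ by an element of both `N_q` and its orthogonal complement.

For monotonicity, let `u₁`, `u₂` be the two solutions with trace `F`. Their difference `w = u₁ - u₂`
lies in `H0s`, so `B_{q₂}(u₂, w) = 0`, and therefore `⟨(Λ(q₁) - Λ(q₂)) F, F⟩ = B_{q₁}(u₁, u₁) -
B_{q₂}(u₂, u₂) = ∫_Ω (q₁ - q₂) u₁² + B_{q₂}(w, w)`. The last term is nonnegative if `w` is
orthogonal to the span `E` of the eigenspaces of `compactPart s q₂` with eigenvalue above `1`, and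
`dim E ≤ d(q₂)`. Since `F ↦ w` is linear and bounded, this orthogonality holds for all `F` in the
kernel of a bounded operator of rank at most `dim E`. The orthogonal complement of that kernel is
`V`. -/

noncomputable section

/-! ### Spectral theory of compact symmetric operators. -/

section CompactSymmetric

variable {H : Type*} [NormedAddCommGroup H] [InnerProductSpace ℝ H]

/-- A bounded operator that is small on the kernels of suitable finite rank operators is
compact. -/
theorem isCompactOperator_of_forall_small_on_ker [CompleteSpace H] {G : Type*}
    [NormedAddCommGroup G] [NormedSpace ℝ G] [CompleteSpace G] (T : H →L[ℝ] G)
    (hT : ∀ ε > 0, ∃ (ι : Type) (_ : Fintype ι) (L : H →L[ℝ] (ι → ℂ)),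
      ∀ u, L u = 0 → ‖T u‖ ≤ ε * ‖u‖) :
    IsCompactOperator T := by
  have hcl : IsClosed {f : H →L[ℝ] G | IsCompactOperator f} := isClosed_setOfPred_isCompactOperator
  refine (hcl.closure_subset_iff.2 subset_rfl) ?_
  rw [Metric.mem_closure_iff]
  intro ε hε
  obtain ⟨ι, _, L, hL⟩ := hT (ε / 2) (by positivity)
  set M : Submodule ℝ H := L.ker with hM
  have hMc : IsClosed (M : Set H) := L.isClosed_ker
  have : CompleteSpace M := hMc.completeSpace_coe
  set Q : H →L[ℝ] H := Mᗮ.starProjection with hQ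
  have hfin : FiniteDimensional ℝ Mᗮ := by
    refine Module.Finite.of_injective ((L : H →ₗ[ℝ] (ι → ℂ)).comp Mᗮ.subtype) ?_
    rw [← LinearMap.ker_eq_bot, LinearMap.ker_eq_bot']
    intro m hm
    have h1 : (m : H) ∈ M := hm
    have := Submodule.inner_right_of_mem_orthogonal h1 m.2
    exact Subtype.ext (inner_self_eq_zero.1 this)
  -- `Q` projects onto a finite-dimensional space, so `T Q` is compact, and `T - T Q` acts only
  -- through the component in the kernel of `L`, where `T` is small.
  refine ⟨T.comp Q, ?_, ?_⟩
  · have h1 : IsCompactOperator (T.comp Mᗮ.subtypeL) :=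
      isCompactOperator_of_locallyCompactSpace_rng (T.comp Mᗮ.subtypeL)
    exact h1.comp_clm Mᗮ.orthogonalProjectionOnto
  · rw [dist_eq_norm]
    refine lt_of_le_of_lt (ContinuousLinearMap.opNorm_le_bound _ (by positivity) fun u => ?_)
      (half_lt_self hε)
    have hu : u - Q u = M.starProjection u := by
      rw [hQ, Submodule.starProjection_orthogonal_val]; abel
    have : (T - T.comp Q) u = T (M.starProjection u) := by
      rw [← hu]; simp
    rw [this]
    refine (hL _ (M.starProjection_apply_mem u)).trans ?_
    gcongr
    exact M.norm_starProjection_apply_le u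

variable {T : H →L[ℝ] H}

/-- **Fredholm alternative** for compact symmetric operators. -/
theorem exists_sub_apply_eq_of_mem_orthogonal [CompleteSpace H] (hT : IsCompactOperator T)
    (hs : (T : H →ₗ[ℝ] H).IsSymmetric) {y : H}
    (hy : y ∈ (Module.End.eigenspace (T : H →ₗ[ℝ] H) 1)ᗮ) : ∃ x, x - T x = y := by
  set N := Module.End.eigenspace (T : H →ₗ[ℝ] H) 1
  have hinv : ∀ v ∈ Nᗮ, (T : H →ₗ[ℝ] H) v ∈ Nᗮ := hs.invariant_orthogonalComplement_eigenspace 1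
  let S : Nᗮ →L[ℝ] Nᗮ := T.restrict hinv
  have hS : IsCompactOperator S := hT.restrict' hinv
  -- An eigenvector of `S` for `1` would lie in `N` and in `Nᗮ`.
  have hne : ¬ Module.End.HasEigenvalue (S : Nᗮ →ₗ[ℝ] Nᗮ) 1 := by
    intro h
    obtain ⟨v, hv, hv0⟩ := h.exists_hasEigenvector
    rw [Module.End.mem_eigenspace_iff] at hv
    have h1 : (v : H) ∈ N := by
      rw [Module.End.mem_eigenspace_iff]
      exact congrArg Subtype.val hv
    exact hv0 (Subtype.ext (inner_self_eq_zero.1 (Submodule.inner_right_of_mem_orthogonal h1 v.2)))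
  have h2 := (hS.hasEigenvalue_or_mem_resolventSet one_ne_zero).resolve_left hne
  rw [spectrum.mem_resolventSet_iff, ContinuousLinearMap.isUnit_iff_bijective] at h2
  obtain ⟨x, hx⟩ := h2.2 ⟨y, hy⟩
  refine ⟨x, ?_⟩
  have := congrArg Subtype.val hx
  simpa [S] using this

/-- The algebraic supremum contains only finite sums of eigenvectors, and these are pairwise
orthogonal. With `I` below or above `1`, this compares `T` with the identity on a dense subspace. -/
theorem LinearMap.IsSymmetric.inner_apply_self_of_mem_iSup_eigenspace {T : H →ₗ[ℝ] H}
    (hs : T.IsSymmetric) {I : Set ℝ} {x : H}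
    (hx : x ∈ ⨆ μ : I, Module.End.eigenspace T (μ : ℝ)) :
    ∃ (t : Finset I) (f : I → H), ‖x‖ ^ 2 = ∑ μ ∈ t, ‖f μ‖ ^ 2 ∧
      ⟪T x, x⟫_ℝ = ∑ μ ∈ t, μ * ‖f μ‖ ^ 2 ∧ ‖T x‖ ^ 2 = ∑ μ ∈ t, (μ : ℝ) ^ 2 * ‖f μ‖ ^ 2 := by
  classical
  have hO : OrthogonalFamily ℝ (fun μ : I => Module.End.eigenspace T (μ : ℝ))
      fun μ => (Module.End.eigenspace T (μ : ℝ)).subtypeₗᵢ :=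
    hs.orthogonalFamily_eigenspaces.comp Subtype.val_injective
  rw [Submodule.mem_iSup_iff_exists_dfinsupp'] at hx
  obtain ⟨f, hf⟩ := hx
  have hf' : x = ∑ μ ∈ f.support, (Module.End.eigenspace T (μ : ℝ)).subtypeₗᵢ (f μ) := by
    rw [← hf]; rfl
  have hTx : T x = ∑ μ ∈ f.support,
      (Module.End.eigenspace T (μ : ℝ)).subtypeₗᵢ ((μ : ℝ) • f μ) := by
    rw [hf', map_sum]
    exact Finset.sum_congr rfl fun μ _ => Module.End.mem_eigenspace_iff.1 (f μ).2
  refine ⟨f.support, fun μ => f μ, ?_, ?_, ?_⟩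
  · rw [hf']
    exact hO.norm_sum _ _
  · rw [hTx, hf', hO.inner_sum]
    simp [real_inner_smul_left]
  · rw [hTx]
    refine (hO.norm_sum (fun μ => (μ : ℝ) • f μ) _).trans ?_
    simp [norm_smul, mul_pow]

/-- On `Eᗮ` no eigenvalue above `1` survives, so by the spectral theorem the eigenvectors with `μ ≤
1` span a dense subspace; the bound holds there and passes to the limit. -/
theorem LinearMap.IsSymmetric.inner_apply_self_le_of_mem_orthogonal [CompleteSpace H]
    (hT : IsCompactOperator T) (hs : (T : H →ₗ[ℝ] H).IsSymmetric) {w : H}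
    (hw : w ∈ (⨆ μ : Set.Ioi (1 : ℝ), Module.End.eigenspace (T : H →ₗ[ℝ] H) (μ : ℝ))ᗮ) :
    ⟪T w, w⟫_ℝ ≤ ‖w‖ ^ 2 := by
  set E := ⨆ μ : Set.Ioi (1 : ℝ), Module.End.eigenspace (T : H →ₗ[ℝ] H) (μ : ℝ) with hE
  have hinv : ∀ v ∈ Eᗮ, (T : H →ₗ[ℝ] H) v ∈ Eᗮ := by
    rw [hE, ← Submodule.iInf_orthogonal]
    exact LinearMap.iInf_invariant _
      fun μ => hs.invariant_orthogonalComplement_eigenspace (μ : ℝ)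
  let S : Eᗮ →L[ℝ] Eᗮ := T.restrict hinv
  have hS : IsCompactOperator S := hT.restrict' hinv
  have hSs : (S : Eᗮ →ₗ[ℝ] Eᗮ).IsSymmetric := hs.restrict_invariant hinv
  have hle : ∀ μ : ℝ, 1 < μ → Module.End.eigenspace (S : Eᗮ →ₗ[ℝ] Eᗮ) μ = ⊥ := by
    intro μ hμ
    rw [eq_bot_iff]
    intro v hv
    rw [Module.End.mem_eigenspace_iff] at hv
    have h1 : (v : H) ∈ E := by
      refine Submodule.mem_iSup_of_mem (⟨μ, hμ⟩ : Set.Ioi (1 : ℝ)) ?_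
      rw [Module.End.mem_eigenspace_iff]
      exact congrArg Subtype.val hv
    exact Subtype.ext (inner_self_eq_zero.1 (Submodule.inner_right_of_mem_orthogonal h1 v.2))
  have hbot := ContinuousLinearMap.orthogonalComplement_iSup_eigenspaces_eq_bot hS hSs
  have hle2 : (⨆ μ, Module.End.eigenspace (S : Eᗮ →ₗ[ℝ] Eᗮ) μ) ≤
      ⨆ μ : Set.Iic (1 : ℝ), Module.End.eigenspace (S : Eᗮ →ₗ[ℝ] Eᗮ) (μ : ℝ) := by
    refine iSup_le fun μ => ?_
    rcases le_or_gt μ 1 with h | h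
    · exact le_iSup (fun μ : Set.Iic (1 : ℝ) =>
        Module.End.eigenspace (S : Eᗮ →ₗ[ℝ] Eᗮ) (μ : ℝ)) ⟨μ, h⟩
    · rw [hle μ h]; exact bot_le
  have hdense : Dense ((⨆ μ : Set.Iic (1 : ℝ),
      Module.End.eigenspace (S : Eᗮ →ₗ[ℝ] Eᗮ) (μ : ℝ) : Submodule ℝ Eᗮ) : Set Eᗮ) := by
    rw [Submodule.dense_iff_topologicalClosure_eq_top, Submodule.topologicalClosure_eq_top_iff,
      eq_bot_iff, ← hbot]
    exact Submodule.orthogonal_le hle2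
  have key : ∀ x : Eᗮ, ⟪S x, x⟫_ℝ ≤ ‖x‖ ^ 2 := by
    intro x
    refine hdense.induction (P := fun x => ⟪S x, x⟫_ℝ ≤ ‖x‖ ^ 2) ?_ ?_ x
    · intro x hx
      obtain ⟨t, f, h1, h2, -⟩ := hSs.inner_apply_self_of_mem_iSup_eigenspace hx
      change ⟪(S : Eᗮ →ₗ[ℝ] Eᗮ) x, x⟫_ℝ ≤ ‖x‖ ^ 2
      rw [h1, h2]
      refine Finset.sum_le_sum fun μ _ => ?_
      nlinarith [sq_nonneg ‖f μ‖, Set.mem_Iic.1 μ.2]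
    · exact isClosed_le (by fun_prop) (by fun_prop)
  exact key ⟨w, hw⟩

/-- On the closure `C` of the span, `T` does not decrease norms. A compact operator that is bounded
below forces the identity of `C` to be compact. -/
theorem LinearMap.IsSymmetric.finiteDimensional_iSup_eigenspace_Ioi_one [CompleteSpace H]
    (hT : IsCompactOperator T) (hs : (T : H →ₗ[ℝ] H).IsSymmetric) :
    FiniteDimensional ℝ
      ↥(⨆ μ : Set.Ioi (1 : ℝ), Module.End.eigenspace (T : H →ₗ[ℝ] H) (μ : ℝ)) := by
  set E := ⨆ μ : Set.Ioi (1 : ℝ), Module.End.eigenspace (T : H →ₗ[ℝ] H) (μ : ℝ) with hE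
  have hEinv : ∀ v ∈ E, T v ∈ E := by
    intro v hv
    have : E ≤ E.comap (T : H →ₗ[ℝ] H) := by
      refine iSup_le fun μ v hv => ?_
      refine Submodule.mem_iSup_of_mem μ ?_
      rw [ContinuousLinearMap.coe_coe, ← ContinuousLinearMap.coe_coe,
        Module.End.mem_eigenspace_iff.1 hv]
      exact Submodule.smul_mem _ _ hv
    exact this hv
  set C := E.topologicalClosure with hC
  have : CompleteSpace C := E.isClosed_topologicalClosure.completeSpace_coe
  have hinv : ∀ v ∈ C, (T : H →ₗ[ℝ] H) v ∈ C := by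
    intro v hv
    exact map_mem_closure T.continuous hv hEinv
  have hbd : ∀ v ∈ C, ‖v‖ ≤ ‖T v‖ := by
    intro v hv
    refine closure_minimal (t := {v | ‖v‖ ≤ ‖T v‖}) ?_ (isClosed_le (by fun_prop) (by fun_prop)) hv
    intro x hx
    obtain ⟨t, f, h1, -, h2⟩ := hs.inner_apply_self_of_mem_iSup_eigenspace hx
    change ‖x‖ ≤ ‖(T : H →ₗ[ℝ] H) x‖
    rw [← sq_le_sq₀ (norm_nonneg _) (norm_nonneg _), h1, h2]
    refine Finset.sum_le_sum fun μ _ => ?_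
    have : (1 : ℝ) < μ := μ.2
    exact le_mul_of_one_le_left (by positivity) (by nlinarith)
  let S : C →L[ℝ] C := T.restrict hinv
  have hS : IsCompactOperator S := hT.restrict' hinv
  have hanti : AntilipschitzWith 1 S := by
    refine AddMonoidHomClass.antilipschitz_of_bound S fun x => ?_
    rw [NNReal.coe_one, one_mul]
    exact hbd x x.2
  have hid : IsCompactOperator (_root_.id : C → C) := by
    obtain ⟨K, hK, hK'⟩ := hS
    exact ⟨S ⁻¹' K, (hanti.isClosedEmbedding S.uniformContinuous).isCompact_preimage hK, hK'⟩
  have : FiniteDimensional ℝ C := FiniteDimensional.of_isCompactOperator_id (𝕜 := ℝ) hid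
  exact Submodule.finiteDimensional_of_le E.le_topologicalClosure

/-- Both `finrank` and `finsum` default to `0` in infinite situations. Finite dimension of the span
excludes this: each eigenspace is finite-dimensional and only finitely many are nonzero. -/
theorem LinearMap.IsSymmetric.finrank_iSup_eigenspace_Ioi_one_le [CompleteSpace H]
    (hT : IsCompactOperator T) (hs : (T : H →ₗ[ℝ] H).IsSymmetric) :
    Module.finrank ℝ
      ↥(⨆ μ : Set.Ioi (1 : ℝ), Module.End.eigenspace (T : H →ₗ[ℝ] H) (μ : ℝ)) ≤
    ∑ᶠ (μ : ℝ) (_ : 1 < μ), Module.finrank ℝ (Module.End.eigenspace (T : H →ₗ[ℝ] H) μ) := by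
  classical
  have := hs.finiteDimensional_iSup_eigenspace_Ioi_one hT
  set A : Set.Ioi (1 : ℝ) → Submodule ℝ H := fun μ => Module.End.eigenspace (T : H →ₗ[ℝ] H) μ
    with hA
  have hind : iSupIndep A :=
    (Module.End.eigenspaces_iSupIndep (T : H →ₗ[ℝ] H)).comp Subtype.val_injective
  -- The eigenspaces are viewed inside their finite-dimensional span, where an independent family
  -- has only finitely many nonzero members.
  set B : Set.Ioi (1 : ℝ) → Submodule ℝ ↥(⨆ μ, A μ) := fun μ => (A μ).comap (⨆ μ, A μ).subtype
  have hAB : ∀ μ, A μ = (B μ).map (⨆ μ, A μ).subtype := fun μ => by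
    rw [Submodule.map_comap_subtype, inf_eq_right.2 (le_iSup A μ)]
  have hfr : ∀ μ, Module.finrank ℝ (B μ) = Module.finrank ℝ (A μ) := fun μ => by
    rw [hAB]
    exact (Submodule.finrank_map_subtype_eq _ _).symm
  have hBind : iSupIndep B := by
    rw [iSupIndep_def]
    intro i
    rw [Submodule.disjoint_def]
    intro x hx hx'
    have hle : (⨆ (j) (_ : j ≠ i), B j) ≤ (⨆ (j) (_ : j ≠ i), A j).comap (⨆ μ, A μ).subtype :=
      iSup₂_le fun j hj => Submodule.comap_mono (le_iSup₂ (f := fun j (_ : j ≠ i) => A j) j hj)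
    exact Subtype.ext (Submodule.disjoint_def.1 (hind i) x hx (hle hx'))
  have hfin : {μ | B μ ≠ ⊥}.Finite := WellFoundedGT.finite_ne_bot_of_iSupIndep hBind
  have hsub : (Function.support fun μ => Module.finrank ℝ (A μ)) ⊆ hfin.toFinset := by
    intro μ hμ
    rw [Set.Finite.coe_toFinset]
    intro h
    refine hμ ?_
    change Module.finrank ℝ (A μ) = 0
    rw [← hfr, h, finrank_bot]
  have hfd : ∀ μ, FiniteDimensional ℝ (A μ) := fun μ =>
    Submodule.finiteDimensional_of_le (le_iSup A μ)
  have hsup : (⨆ μ, A μ) ≤ hfin.toFinset.sup A := by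
    refine iSup_le fun μ => ?_
    by_cases h : B μ = ⊥
    · rw [hAB, h, Submodule.map_bot]; exact bot_le
    · exact Finset.le_sup (hfin.mem_toFinset.2 h)
  have hsum : ∀ t : Finset (Set.Ioi (1 : ℝ)),
      Module.finrank ℝ ↥(t.sup A) ≤ ∑ μ ∈ t, Module.finrank ℝ (A μ) := by
    intro t
    induction t using Finset.induction_on with
    | empty => simp
    | insert a t ha ih =>
      rw [Finset.sup_insert, Finset.sum_insert ha]
      exact (Submodule.finrank_add_le_finrank_add_finrank _ _).trans (by gcongr)
  calc Module.finrank ℝ ↥(⨆ μ, A μ) ≤ Module.finrank ℝ ↥(hfin.toFinset.sup A) :=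
        Submodule.finrank_mono hsup
    _ ≤ ∑ μ ∈ hfin.toFinset, Module.finrank ℝ (A μ) := hsum _
    _ = ∑ᶠ μ, Module.finrank ℝ (A μ) := (finsum_eq_sum_of_support_subset _ hsub).symm
    _ = _ := finsum_subtype_eq_finsum_cond
        (f := fun μ => Module.finrank ℝ (Module.End.eigenspace (T : H →ₗ[ℝ] H) μ)) (1 < ·)

end CompactSymmetric

/-! ### Rellich's theorem by Fourier transform. -/

namespace FracSchrodinger

variable {n : ℕ} {s : ℝ} {Ω : Set (Eucl n)}

theorem norm_sq_eq_toL2_add_halfFracLaplacian (u : Hs n s) :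
    ‖u‖ ^ 2 = ‖toL2 u‖ ^ 2 + ‖halfFracLaplacian u‖ ^ 2 :=
  WithLp.prod_norm_sq_eq_of_L2 (u : WithLp 2 (L2 n × L2 n))

theorem inner_eq_toL2_add_halfFracLaplacian (u w : Hs n s) :
    ⟪u, w⟫_ℝ = ⟪toL2 u, toL2 w⟫_ℝ + ⟪halfFracLaplacian u, halfFracLaplacian w⟫_ℝ := rfl

theorem norm_toL2_le (u : Hs n s) : ‖toL2 u‖ ≤ ‖u‖ := by
  have := norm_sq_eq_toL2_add_halfFracLaplacian u
  exact abs_le_of_sq_le_sq' (by nlinarith [sq_nonneg ‖halfFracLaplacian u‖]) (norm_nonneg _) |>.2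

theorem complexify_ae (f : L2 n) : complexify n f =ᵐ[volume] fun x => ((f x : ℝ) : ℂ) :=
  ContinuousLinearMap.coeFn_compLpL _ f

theorem norm_complexify (f : L2 n) : ‖complexify n f‖ = ‖f‖ := by
  refine le_antisymm (Lp.norm_le_norm_of_ae_le ?_) (Lp.norm_le_norm_of_ae_le ?_) <;>
  · filter_upwards [complexify_ae f] with x hx
    rw [hx, Complex.norm_real]

theorem integrable_norm_sq_Lp (f : Lp ℂ 2 (volume : Measure (Eucl n))) :
    Integrable fun x => ‖f x‖ ^ 2 :=
  (Lp.memLp f).norm.integrable_sq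

theorem norm_sq_Lp_eq_integral (f : Lp ℂ 2 (volume : Measure (Eucl n))) :
    ‖f‖ ^ 2 = ∫ x, ‖f x‖ ^ 2 := by
  have h : ⟪f, f⟫_ℂ = ((‖f‖ ^ 2 : ℝ) : ℂ) := by
    rw [inner_self_eq_norm_sq_to_K]; norm_cast
  have h2 : ∫ x, ⟪f x, f x⟫_ℂ = ((∫ x, ‖f x‖ ^ 2 : ℝ) : ℂ) := by
    rw [← integral_complex_ofReal]
    refine integral_congr_ae (Eventually.of_forall fun x => ?_)
    change ⟪f x, f x⟫_ℂ = _
    rw [inner_self_eq_norm_sq_to_K]; norm_cast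
  exact Complex.ofReal_injective (h.symm.trans ((L2.inner_def f f).trans h2))

theorem norm_fourierChar_sub_le (a b : ℝ) :
    ‖(Real.fourierChar a : ℂ) - Real.fourierChar b‖ ≤ 2 * Real.pi * |a - b| := by
  have h : (Real.fourierChar a : ℂ) - Real.fourierChar b =
      Real.fourierChar b * (Complex.exp (Complex.I * ((2 * Real.pi * (a - b) : ℝ) : ℂ)) - 1) := by
    rw [Real.fourierChar_apply, Real.fourierChar_apply, mul_sub, ← Complex.exp_add, mul_one]
    congr 2
    push_cast
    ring
  rw [h, norm_mul, Circle.norm_coe, one_mul]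
  refine Real.norm_exp_I_mul_ofReal_sub_one_le.trans ?_
  rw [Real.norm_eq_abs, abs_mul, abs_of_pos Real.two_pi_pos]

variable (Ω) in
/-- The plane wave with frequency `ξ` as an element of `L²(Ω)`, for a set `Ω` of finite
measure. -/
def planeWave [IsFiniteMeasure ((volume : Measure (Eucl n)).restrict Ω)] (ξ : Eucl n) :
    Lp ℂ 2 ((volume : Measure (Eucl n)).restrict Ω) :=
  MemLp.toLp (fun x : Eucl n => (Real.fourierChar ⟪x, ξ⟫_ℝ : ℂ)) (by
    refine MemLp.of_bound (C := 1) (Continuous.aestronglyMeasurable ?_) ?_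
    · exact continuous_induced_dom.comp (Real.continuous_fourierChar.comp (by fun_prop))
    · exact Eventually.of_forall fun x => (Circle.norm_coe _).le)

variable [IsFiniteMeasure ((volume : Measure (Eucl n)).restrict Ω)]

theorem planeWave_ae (ξ : Eucl n) : planeWave Ω ξ =ᵐ[volume.restrict Ω]
    fun x => (Real.fourierChar ⟪x, ξ⟫_ℝ : ℂ) := MemLp.coeFn_toLp _

/-- For `‖x‖ ≤ ρ` the phase `2π x·ξ` is `2πρ`-Lipschitz in `ξ`; finite measure turns this uniform
bound into an `L²(Ω)` bound. -/
theorem exists_norm_planeWave_sub_le (hΩ : MeasurableSet Ω) (hΩb : Bornology.IsBounded Ω) :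
    ∃ C : ℝ, 0 ≤ C ∧ ∀ ξ η, ‖planeWave Ω ξ - planeWave Ω η‖ ≤ C * ‖ξ - η‖ := by
  obtain ⟨ρ, hρ, hΩρ⟩ := hΩb.exists_pos_norm_le
  set m : ℝ := measureUnivNNReal (volume.restrict Ω) ^ (2 : ℝ≥0∞).toReal⁻¹ with hm
  refine ⟨m * (2 * Real.pi * ρ), by positivity, fun ξ η => ?_⟩
  rw [mul_assoc]
  refine Lp.norm_le_of_ae_bound (by positivity) ?_
  filter_upwards [Lp.coeFn_sub (planeWave Ω ξ) (planeWave Ω η), planeWave_ae ξ, planeWave_ae η,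
    ae_restrict_mem hΩ] with x h1 h2 h3 hx
  rw [h1, Pi.sub_apply, h2, h3]
  refine (norm_fourierChar_sub_le _ _).trans ?_
  rw [← inner_sub_right, mul_assoc (2 * Real.pi)]
  gcongr
  exact (abs_real_inner_le_norm _ _).trans (by gcongr; exact hΩρ x hx)

variable (Ω) in
/-- The value at `ξ` of the Fourier transform of `u 1_Ω`, as a functional on `H^s(ℝⁿ)`. -/
def fourierEval (ξ : Eucl n) : Hs n s →L[ℝ] ℂ :=
  ((innerSL ℂ (planeWave Ω ξ)).restrictScalars ℝ).comp
    ((LpToLpRestrictCLM (Eucl n) ℂ ℝ volume 2 Ω).comp ((complexify n).comp toL2))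

theorem norm_fourierEval_sub_le (ξ η : Eucl n) (u : Hs n s) :
    ‖fourierEval Ω ξ u - fourierEval Ω η u‖ ≤ ‖planeWave Ω ξ - planeWave Ω η‖ * ‖u‖ := by
  set v := LpToLpRestrictCLM (Eucl n) ℂ ℝ volume 2 Ω (complexify n (toL2 u)) with hv
  have h : fourierEval Ω ξ u - fourierEval Ω η u = ⟪planeWave Ω ξ - planeWave Ω η, v⟫_ℂ := by
    rw [inner_sub_left]; rfl
  rw [h]
  refine (norm_inner_le_norm _ _).trans ?_
  gcongr
  calc ‖v‖ ≤ ‖complexify n (toL2 u)‖ := norm_Lp_toLp_restrict_le _ _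
    _ = ‖toL2 u‖ := norm_complexify _
    _ ≤ ‖u‖ := norm_toL2_le u

/-- A test function is a Schwartz function, so its `L²` Fourier transform is the integral, which
reduces to `Ω`. This gives point values of the transform that depend continuously on `u`. -/
theorem fourier_complexify_ae_of_mem_testFunctions {u : Hs n s} (hu : u ∈ testFunctions n s Ω) :
    (𝓕 (complexify n (toL2 u)) : Lp ℂ 2 (volume : Measure (Eucl n))) =ᵐ[volume]
      fun ξ => fourierEval Ω ξ u := by
  obtain ⟨φ, h1, h2, h3, h4⟩ := hu
  have hc : HasCompactSupport fun x => ((φ x : ℝ) : ℂ) := h2.comp_left (g := Complex.ofReal) rfl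
  have hs : ContDiff ℝ ∞ fun x => ((φ x : ℝ) : ℂ) := Complex.ofRealCLM.contDiff.comp h1
  set ψ : SchwartzMap (Eucl n) ℂ := hc.toSchwartzMap hs with hψ
  have hψx : ∀ x, ψ x = ((φ x : ℝ) : ℂ) := fun _ => rfl
  have e1 : complexify n (toL2 u) = ψ.toLp 2 := by
    refine Lp.ext ?_
    filter_upwards [complexify_ae (toL2 u), ψ.coeFn_toLp 2, h4] with x a b c
    rw [a, b, c, hψx]
  rw [e1, SchwartzMap.toLp_fourier_eq]
  filter_upwards [(𝓕 ψ).coeFn_toLp 2] with ξ hξ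
  rw [hξ, SchwartzMap.fourier_coe, Real.fourier_eq]
  have e2 : fourierEval Ω ξ u = ⟪planeWave Ω ξ,
      LpToLpRestrictCLM (Eucl n) ℂ ℝ volume 2 Ω (complexify n (toL2 u))⟫_ℂ := rfl
  rw [e2, L2.inner_def, ← setIntegral_eq_integral_of_forall_compl_eq_zero (s := Ω)]
  · refine integral_congr_ae ?_
    filter_upwards [planeWave_ae (Ω := Ω) ξ,
      LpToLpRestrictCLM_coeFn (𝕜 := ℝ) Ω (complexify n (toL2 u)),
      ae_restrict_of_ae (complexify_ae (toL2 u)), ae_restrict_of_ae h4] with x a b c d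
    rw [a, b, c, d, hψx, Circle.smul_def, AddChar.map_neg_eq_inv, Circle.coe_inv_eq_conj]
    simp [mul_comm]
  · intro x hx
    have : φ x = 0 := image_eq_zero_of_notMem_tsupport fun h => hx (h3 h)
    rw [hψx, this]
    simp

/-- Plancherel, split at `‖ξ‖ = R`: inside, the transform is bounded by `M`; outside, the symbol is
so large that `|û|²` is at most `ε` times the squared transform of `(-Δ)^(s/2) u`. -/
theorem norm_sq_toL2_le_of_mem_testFunctions {u : Hs n s} (hs : 0 ≤ s)
    (hu : u ∈ testFunctions n s Ω) {R M ε : ℝ} (hR : 0 ≤ R)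
    (hM : ∀ ξ ∈ Metric.closedBall (0 : Eucl n) R, ‖fourierEval Ω ξ u‖ ^ 2 ≤ M) (hε : 0 ≤ ε)
    (hRε : 1 ≤ ε * ((2 * Real.pi * R) ^ s) ^ 2) :
    ‖toL2 u‖ ^ 2 ≤ M * volume.real (Metric.closedBall (0 : Eucl n) R) + ε * ‖u‖ ^ 2 := by
  set B := Metric.closedBall (0 : Eucl n) R
  have hB : MeasurableSet B := measurableSet_closedBall
  set f := 𝓕 (complexify n (toL2 u)) with hf
  set g := 𝓕 (complexify n (halfFracLaplacian u)) with hg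
  have hfn : ‖f‖ = ‖toL2 u‖ := by rw [hf, Lp.norm_fourier_eq, norm_complexify]
  have hgn : ‖g‖ = ‖halfFracLaplacian u‖ := by rw [hg, Lp.norm_fourier_eq, norm_complexify]
  have hfg : ∀ᵐ ξ, g ξ = (((2 * Real.pi * ‖ξ‖) ^ s : ℝ) : ℂ) * f ξ := u.2
  rw [← hfn, norm_sq_Lp_eq_integral, ← integral_add_compl hB (integrable_norm_sq_Lp f)]
  refine add_le_add ?_ ?_
  · have : ∫ ξ in B, ‖f ξ‖ ^ 2 ≤ ∫ ξ in B, M := by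
      refine integral_mono_ae (integrable_norm_sq_Lp f).integrableOn
        (integrableOn_const (measure_closedBall_lt_top.ne)) ?_
      filter_upwards [ae_restrict_of_ae (fourier_complexify_ae_of_mem_testFunctions hu),
        ae_restrict_mem hB] with ξ h1 h2
      change ‖f ξ‖ ^ 2 ≤ M
      rw [h1]
      exact hM ξ h2
    refine this.trans_eq ?_
    rw [setIntegral_const, smul_eq_mul, mul_comm]
  · calc ∫ ξ in Bᶜ, ‖f ξ‖ ^ 2 ≤ ∫ ξ in Bᶜ, ε * ‖g ξ‖ ^ 2 := by
          refine integral_mono_ae (integrable_norm_sq_Lp f).integrableOn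
            ((integrable_norm_sq_Lp g).const_mul ε).integrableOn ?_
          filter_upwards [ae_restrict_of_ae hfg, ae_restrict_mem hB.compl] with ξ h1 h2
          have hξ : R ≤ ‖ξ‖ := by
            have : ¬ ‖ξ‖ ≤ R := by simpa [B] using h2
            linarith
          have hle : (2 * Real.pi * R) ^ s ≤ (2 * Real.pi * ‖ξ‖) ^ s := by gcongr
          change ‖f ξ‖ ^ 2 ≤ ε * ‖g ξ‖ ^ 2
          rw [h1, norm_mul, mul_pow, Complex.norm_real, Real.norm_eq_abs, sq_abs, ← mul_assoc]
          refine le_mul_of_one_le_left (by positivity) (hRε.trans ?_)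
          gcongr
      _ ≤ ∫ ξ, ε * ‖g ξ‖ ^ 2 :=
          setIntegral_le_integral ((integrable_norm_sq_Lp g).const_mul ε)
            (Eventually.of_forall fun ξ => by positivity)
      _ = ε * ‖halfFracLaplacian u‖ ^ 2 := by
          rw [integral_const_mul, ← norm_sq_Lp_eq_integral, hgn]
      _ ≤ ε * ‖u‖ ^ 2 := by
          gcongr
          have := norm_sq_eq_toL2_add_halfFracLaplacian u
          exact abs_le_of_sq_le_sq' (by nlinarith [sq_nonneg ‖toL2 u‖]) (norm_nonneg _) |>.2

/-- High frequencies cost `ε / 2` for large `R`. On the ball of radius `R` the transform is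
Lipschitz with constant `K ‖u‖`, so its values on a fine finite net control it up to another `ε /
2`. -/
theorem exists_finset_norm_sq_toL2_le (hs : 0 < s) (hΩ : MeasurableSet Ω)
    (hΩb : Bornology.IsBounded Ω) {ε : ℝ} (hε : 0 < ε) :
    ∃ (t : Finset (Eucl n)) (C : ℝ), ∀ u ∈ H0s n s Ω,
      ‖toL2 u‖ ^ 2 ≤ ε * ‖u‖ ^ 2 + C * ∑ ξ ∈ t, ‖fourierEval Ω ξ u‖ ^ 2 := by
  obtain ⟨K, hK0, hK⟩ := exists_norm_planeWave_sub_le hΩ hΩb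
  obtain ⟨R, hR, hR1⟩ : ∃ R : ℝ, 0 ≤ R ∧ 1 ≤ ε / 2 * ((2 * Real.pi * R) ^ s) ^ 2 := by
    have h1 : Tendsto (fun R : ℝ => ε / 2 * ((2 * Real.pi * R) ^ s) ^ 2) atTop atTop :=
      ((tendsto_pow_atTop two_ne_zero).comp ((tendsto_rpow_atTop hs).comp
        (tendsto_id.const_mul_atTop Real.two_pi_pos))).const_mul_atTop (by positivity)
    exact ((eventually_ge_atTop 0).and (h1.eventually_ge_atTop 1)).exists
  set b := volume.real (Metric.closedBall (0 : Eucl n) R) with hb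
  obtain ⟨δ, hδ, hδ1⟩ : ∃ δ : ℝ, 0 < δ ∧ 2 * (K * δ) ^ 2 * b ≤ ε / 2 := by
    have h1 : Tendsto (fun δ : ℝ => 2 * (K * δ) ^ 2 * b) (𝓝[>] 0) (𝓝 0) := by
      have : Continuous fun δ : ℝ => 2 * (K * δ) ^ 2 * b := by fun_prop
      simpa using (this.tendsto 0).mono_left nhdsWithin_le_nhds
    have h0 : ∀ᶠ δ : ℝ in 𝓝[>] 0, 0 < δ := self_mem_nhdsWithin
    exact (h0.and (h1.eventually_le_const (by positivity))).exists
  obtain ⟨t, -, htf, ht⟩ := (isCompact_closedBall (0 : Eucl n) R).finite_cover_balls hδ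
  refine ⟨htf.toFinset, 2 * b, fun u hu => ?_⟩
  -- Both sides are continuous in `u`, so test functions suffice.
  refine closure_minimal (t := {u : Hs n s | ‖toL2 u‖ ^ 2 ≤ ε * ‖u‖ ^ 2 +
    2 * b * ∑ ξ ∈ htf.toFinset, ‖fourierEval Ω ξ u‖ ^ 2}) ?_
    (isClosed_le (by fun_prop) (by fun_prop)) hu
  intro u hu
  set S := ∑ ξ ∈ htf.toFinset, ‖fourierEval Ω ξ u‖ ^ 2 with hS
  have hM : ∀ ξ ∈ Metric.closedBall (0 : Eucl n) R,
      ‖fourierEval Ω ξ u‖ ^ 2 ≤ 2 * (K * δ) ^ 2 * ‖u‖ ^ 2 + 2 * S := by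
    intro ξ hξ
    obtain ⟨η, hη, hξη⟩ := Set.mem_iUnion₂.1 (ht hξ)
    have h1 : ‖fourierEval Ω η u‖ ^ 2 ≤ S :=
      Finset.single_le_sum (f := fun ξ => ‖fourierEval Ω ξ u‖ ^ 2) (fun _ _ => by positivity)
        (htf.mem_toFinset.2 hη)
    have h2 : ‖fourierEval Ω ξ u - fourierEval Ω η u‖ ≤ K * δ * ‖u‖ := by
      refine (norm_fourierEval_sub_le ξ η u).trans ?_
      gcongr
      refine (hK ξ η).trans ?_
      gcongr
      rw [← dist_eq_norm]
      exact (Metric.mem_ball.1 hξη).le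
    have h3 : ‖fourierEval Ω ξ u‖ ≤ K * δ * ‖u‖ + ‖fourierEval Ω η u‖ := by
      have := norm_add_le (fourierEval Ω ξ u - fourierEval Ω η u) (fourierEval Ω η u)
      rw [sub_add_cancel] at this
      linarith
    calc ‖fourierEval Ω ξ u‖ ^ 2 ≤ (K * δ * ‖u‖ + ‖fourierEval Ω η u‖) ^ 2 := by gcongr
      _ ≤ 2 * (K * δ) ^ 2 * ‖u‖ ^ 2 + 2 * ‖fourierEval Ω η u‖ ^ 2 := by
        nlinarith [sq_nonneg (K * δ * ‖u‖ - ‖fourierEval Ω η u‖)]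
      _ ≤ _ := by gcongr
  have h := norm_sq_toL2_le_of_mem_testFunctions hs.le hu hR hM (by positivity) hR1
  have h5 : 2 * (K * δ) ^ 2 * b * ‖u‖ ^ 2 ≤ ε / 2 * ‖u‖ ^ 2 := by gcongr
  change ‖toL2 u‖ ^ 2 ≤ ε * ‖u‖ ^ 2 + 2 * b * S
  rw [← hb] at h
  nlinarith

/-- The **Rellich theorem**: `H₀^s(Ω)` is compactly embedded into `L²(Ω)`. -/
theorem isCompactOperator_embed (hs : 0 < s) (hΩ : MeasurableSet Ω)
    (hΩb : Bornology.IsBounded Ω) : IsCompactOperator (embed s Ω) := by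
  apply isCompactOperator_of_forall_small_on_ker (H := H0s n s Ω) (G := L2On Ω)
  intro ε hε
  obtain ⟨t, C, h⟩ := exists_finset_norm_sq_toL2_le hs hΩ hΩb (ε := ε ^ 2) (by positivity)
  refine ⟨Fin t.card, inferInstance,
    ContinuousLinearMap.pi fun i => (fourierEval Ω (t.equivFin.symm i : Eucl n)).comp
      (H0s n s Ω).subtypeL, fun u hu => ?_⟩
  have h0 : ∀ ξ ∈ t, fourierEval Ω ξ (u : Hs n s) = 0 := fun ξ hξ => by
    simpa using congrFun hu (t.equivFin ⟨ξ, hξ⟩)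
  have h1 := h u u.2
  rw [Finset.sum_eq_zero fun ξ hξ => by rw [h0 ξ hξ]; simp, mul_zero, add_zero, ← mul_pow] at h1
  have h2 := (abs_le_of_sq_le_sq' h1 (by positivity)).2
  exact (norm_Lp_toLp_restrict_le _ _).trans h2

end FracSchrodinger

/-! ### Hilbert space tools: finite rank, weak solvability, bounded inverses. -/

/-- The kernel of a finite rank operator on a Hilbert space has a small orthogonal complement. -/
theorem exists_submodule_rank_le_and_forall_mem_orthogonal {X E : Type*} [NormedAddCommGroup X]
    [InnerProductSpace ℝ X] [CompleteSpace X] [NormedAddCommGroup E] [NormedSpace ℝ E]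
    [FiniteDimensional ℝ E] (L : X →L[ℝ] E) :
    ∃ V : Submodule ℝ X, Module.rank ℝ V ≤ Module.finrank ℝ E ∧ ∀ v ∈ Vᗮ, L v = 0 := by
  have hc : CompleteSpace L.ker := L.isClosed_ker.completeSpace_coe
  have hinj : Function.Injective ((L : X →ₗ[ℝ] E).comp L.kerᗮ.subtype) := by
    rw [← LinearMap.ker_eq_bot, LinearMap.ker_eq_bot']
    intro m hm
    have h1 : (m : X) ∈ L.ker := hm
    exact Subtype.ext (inner_self_eq_zero.1 (Submodule.inner_right_of_mem_orthogonal h1 m.2))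
  have hfd : FiniteDimensional ℝ L.kerᗮ := Module.Finite.of_injective _ hinj
  refine ⟨L.kerᗮ, ?_, fun v hv => ?_⟩
  · rw [← Module.finrank_eq_rank]
    exact_mod_cast LinearMap.finrank_le_finrank_of_injective hinj
  · rw [Submodule.orthogonal_orthogonal] at hv
    exact hv

theorem inner_adjoint_comp_sub_adjoint_comp {H G : Type*} [NormedAddCommGroup H]
    [InnerProductSpace ℝ H] [CompleteSpace H] [NormedAddCommGroup G] [InnerProductSpace ℝ G]
    [CompleteSpace G] (ι : H →L[ℝ] G) (M : G →L[ℝ] G) (u w : H) :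
    ⟪(ι.adjoint.comp ι - ι.adjoint.comp (M.comp ι)) u, w⟫_ℝ = ⟪ι u - M (ι u), ι w⟫_ℝ := by
  simp [inner_sub_left, ContinuousLinearMap.adjoint_inner_left]

theorem isCompactOperator_adjoint_comp_sub_adjoint_comp {H G : Type*} [NormedAddCommGroup H]
    [InnerProductSpace ℝ H] [CompleteSpace H] [NormedAddCommGroup G] [InnerProductSpace ℝ G]
    [CompleteSpace G] {ι : H →L[ℝ] G} (M : G →L[ℝ] G) (hι : IsCompactOperator ι) :
    IsCompactOperator (ι.adjoint.comp ι - ι.adjoint.comp (M.comp ι)) :=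
  (hι.clm_comp ι.adjoint).sub (hι.clm_comp (ι.adjoint.comp M))

theorem isSymmetric_of_inner_sub_comm {H : Type*} [NormedAddCommGroup H] [InnerProductSpace ℝ H]
    {T : H →L[ℝ] H} (h : ∀ u w, ⟪u - T u, w⟫_ℝ = ⟪w - T w, u⟫_ℝ) :
    (T : H →ₗ[ℝ] H).IsSymmetric := by
  intro u w
  have h1 := h u w
  rw [inner_sub_left, inner_sub_left, real_inner_comm u w, sub_right_inj] at h1
  exact h1.trans (real_inner_comm _ _)

/-- The Fredholm alternative in weak form, applied to the Riesz representative of `φ`. -/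
theorem exists_forall_inner_sub_apply_eq {H : Type*} [NormedAddCommGroup H]
    [InnerProductSpace ℝ H] [CompleteSpace H] {T : H →L[ℝ] H} (hT : IsCompactOperator T)
    (hs : (T : H →ₗ[ℝ] H).IsSymmetric) {φ : StrongDual ℝ H}
    (hφ : ∀ w ∈ Module.End.eigenspace (T : H →ₗ[ℝ] H) 1, φ w = 0) :
    ∃ x, ∀ w, ⟪x - T x, w⟫_ℝ = φ w := by
  have hy : ∀ w, ⟪(InnerProductSpace.toDual ℝ H).symm φ, w⟫_ℝ = φ w := fun w =>
    InnerProductSpace.toDual_symm_apply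
  obtain ⟨x, hx⟩ := exists_sub_apply_eq_of_mem_orthogonal hT hs
    (y := (InnerProductSpace.toDual ℝ H).symm φ)
    ((Submodule.mem_orthogonal' _ _).2 fun w hw => (hy w).trans (hφ w hw))
  exact ⟨x, fun w => by rw [hx, hy]⟩

/-- The quadratic form of `1 - T` is nonnegative off a space whose dimension is the number of
eigenvalues of `T` that are greater than `1`. -/
theorem exists_submodule_forall_inner_sub_apply_nonneg {X H : Type*} [NormedAddCommGroup X]
    [InnerProductSpace ℝ X] [CompleteSpace X] [NormedAddCommGroup H] [InnerProductSpace ℝ H]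
    [CompleteSpace H] {T : H →L[ℝ] H} (hT : IsCompactOperator T)
    (hs : (T : H →ₗ[ℝ] H).IsSymmetric) (D : X →L[ℝ] H) :
    ∃ V : Submodule ℝ X, Module.rank ℝ V ≤ (∑ᶠ (μ : ℝ) (_ : 1 < μ), Module.finrank ℝ
        (Module.End.eigenspace (T : H →ₗ[ℝ] H) μ) : ℕ) ∧
      ∀ F ∈ Vᗮ, 0 ≤ ⟪D F - T (D F), D F⟫_ℝ := by
  let E : Submodule ℝ H := ⨆ μ : Set.Ioi (1 : ℝ),
    Module.End.eigenspace (T : H →ₗ[ℝ] H) (μ : ℝ)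
  have hE : FiniteDimensional ℝ E := hs.finiteDimensional_iSup_eigenspace_Ioi_one hT
  -- `V` is the orthogonal complement of the kernel of `P_E D`, so `F ∈ Vᗮ` gives `D F ∈ Eᗮ`.
  obtain ⟨V, hV, hV'⟩ := exists_submodule_rank_le_and_forall_mem_orthogonal
    (E.orthogonalProjectionOnto.comp D)
  refine ⟨V, hV.trans (Nat.cast_le.2 (hs.finrank_iSup_eigenspace_Ioi_one_le hT)),
    fun F hF => ?_⟩
  have hD : D F ∈ Eᗮ := Submodule.orthogonalProjectionOnto_eq_zero_iff.1 (hV' F hF)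
  have hle := LinearMap.IsSymmetric.inner_apply_self_le_of_mem_orthogonal hT hs hD
  rw [inner_sub_left, real_inner_self_eq_norm_sq]
  linarith

/-- A bounded bijection between closed subspaces has a bounded inverse. -/
theorem exists_continuousLinearMap_rightInverse {H G : Type*} [NormedAddCommGroup H]
    [NormedSpace ℝ H] [CompleteSpace H] [NormedAddCommGroup G] [NormedSpace ℝ G]
    [CompleteSpace G] (A : H →L[ℝ] G) {S : Submodule ℝ H} {B : Submodule ℝ G}
    (hS : IsClosed (S : Set H)) (hB : IsClosed (B : Set G)) (hA : Set.BijOn A S B) :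
    ∃ R : B →L[ℝ] H, ∀ b, R b ∈ S ∧ A (R b) = b := by
  have h1 : CompleteSpace S := hS.completeSpace_coe
  have h2 : CompleteSpace B := hB.completeSpace_coe
  let A' : S →L[ℝ] B := (A.comp S.subtypeL).codRestrict _ fun u => hA.mapsTo u.2
  have hinj : A'.ker = ⊥ := LinearMap.ker_eq_bot.2 fun u v huv =>
    Subtype.ext (hA.injOn u.2 v.2 (congrArg Subtype.val huv))
  have hsurj : A'.range = ⊤ := LinearMap.range_eq_top.2 fun b => by
    obtain ⟨u, hu, hub⟩ := hA.surjOn b.2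
    exact ⟨⟨u, hu⟩, Subtype.ext hub⟩
  let e := ContinuousLinearEquiv.ofBijective A' hinj hsurj
  refine ⟨S.subtypeL.comp (e.symm : B →L[ℝ] S), fun b => ⟨(e.symm b).2, ?_⟩⟩
  exact congrArg Subtype.val (e.apply_symm_apply b)

/-! ### The Dirichlet problem as a Fredholm problem. -/

namespace FracSchrodinger

variable {n : ℕ} {s : ℝ} {Ω : Set (Eucl n)}

/-- Test functions vanish off `Ω`, and the identity is closed under limits; no regularity of the
boundary is needed. -/
theorem inner_toL2_eq_inner_restrictL2 {u : Hs n s} (hu : u ∈ H0s n s Ω) (w : Hs n s) :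
    ⟪toL2 u, toL2 w⟫_ℝ = ⟪restrictL2 Ω u, restrictL2 Ω w⟫_ℝ := by
  refine closure_minimal
    (t := {u : Hs n s | ⟪toL2 u, toL2 w⟫_ℝ = ⟪restrictL2 Ω u, restrictL2 Ω w⟫_ℝ}) ?_
    (isClosed_eq (by fun_prop) (by fun_prop)) hu
  rintro u ⟨φ, -, -, h3, h4⟩
  change ⟪toL2 u, toL2 w⟫_ℝ = ⟪restrictL2 Ω u, restrictL2 Ω w⟫_ℝ
  rw [L2.inner_def, L2.inner_def, ← setIntegral_eq_integral_of_ae_compl_eq_zero (s := Ω)]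
  · refine integral_congr_ae ?_
    filter_upwards [restrictL2_ae (Ω := Ω) u, restrictL2_ae (Ω := Ω) w] with x a b
    rw [a, b]
  · filter_upwards [h4] with x hx hxΩ
    have : φ x = 0 := image_eq_zero_of_notMem_tsupport fun h => hxΩ (h3 h)
    rw [hx, this, inner_zero_left]

theorem form_eq_inner_sub_compactPart (q : LInftyOn Ω)
    (u w : H0s n s Ω) : form q (u : Hs n s) (w : Hs n s) = ⟪u - compactPart s q u, w⟫_ℝ := by
  have h2 : ⟪compactPart s q u, w⟫_ℝ = ⟪embed s Ω u - mulOp q (embed s Ω u), embed s Ω w⟫_ℝ := by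
    apply inner_adjoint_comp_sub_adjoint_comp (H := H0s n s Ω) (G := L2On Ω)
  have h3 : ⟪u, w⟫_ℝ = ⟪embed s Ω u, embed s Ω w⟫_ℝ +
      ⟪halfFracLaplacian (u : Hs n s), halfFracLaplacian (w : Hs n s)⟫_ℝ := by
    change ⟪(u : Hs n s), (w : Hs n s)⟫_ℝ = _
    rw [inner_eq_toL2_add_halfFracLaplacian, inner_toL2_eq_inner_restrictL2 u.2]
    rfl
  have h4 : ⟪u - compactPart s q u, w⟫_ℝ = ⟪u, w⟫_ℝ - ⟪compactPart s q u, w⟫_ℝ := by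
    apply inner_sub_left (E := H0s n s Ω)
  rw [h4, h2, h3, inner_sub_left, form_eq_inner]
  change _ + ⟪mulOp q (embed s Ω u), embed s Ω w⟫_ℝ = _
  ring

theorem isSymmetric_compactPart (q : LInftyOn Ω) :
    LinearMap.IsSymmetric (𝕜 := ℝ) (E := H0s n s Ω)
      (compactPart s q : H0s n s Ω →ₗ[ℝ] H0s n s Ω) := by
  apply isSymmetric_of_inner_sub_comm (H := H0s n s Ω)
  intro u w
  rw [← form_eq_inner_sub_compactPart, ← form_eq_inner_sub_compactPart, form_comm]

theorem isCompactOperator_compactPart (hs : 0 < s) (hΩ : MeasurableSet Ω)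
    (hΩb : Bornology.IsBounded Ω) (q : LInftyOn Ω) :
    IsCompactOperator (compactPart s q : H0s n s Ω →L[ℝ] H0s n s Ω) := by
  have : IsFiniteMeasure ((volume : Measure (Eucl n)).restrict Ω) :=
    isFiniteMeasure_restrict.2 hΩb.measure_lt_top.ne
  apply isCompactOperator_adjoint_comp_sub_adjoint_comp (H := H0s n s Ω) (G := L2On Ω)
  exact isCompactOperator_embed hs hΩ hΩb

theorem solves_zero_iff {q : LInftyOn Ω} {u : Hs n s} :
    Solves q 0 u ↔ ∀ w ∈ H0s n s Ω, form q u w = 0 := by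
  refine forall₂_congr fun w _ => ?_
  rw [integral_eq_inner, inner_zero_left]

theorem continuous_form_left (q : LInftyOn Ω) (w : Hs n s) : Continuous fun u => form q u w := by
  simp_rw [form_eq_inner]
  fun_prop

theorem form_sub_left (q : LInftyOn Ω) (u v w : Hs n s) :
    form q (u - v) w = form q u w - form q v w := by
  simp only [form_eq_inner, map_sub, inner_sub_left]
  ring

theorem form_sub_right (q : LInftyOn Ω) (u v w : Hs n s) :
    form q u (v - w) = form q u v - form q u w := by
  rw [form_comm, form_sub_left, form_comm q v, form_comm q w]

theorem isClosed_homSolutions (q : LInftyOn Ω) :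
    IsClosed (homSolutions s q : Set (Hs n s)) := by
  have h : (homSolutions s q : Set (Hs n s)) =
      (H0s n s Ω : Set (Hs n s)) ∩ ⋂ w ∈ H0s n s Ω, {u | form q u w = 0} := by
    ext u
    simp only [Set.mem_inter_iff, Set.mem_iInter]
    exact and_congr_right fun _ => solves_zero_iff
  rw [h]
  exact (instIsClosedH0s Ω).inter (isClosed_biInter fun w _ =>
    isClosed_eq (continuous_form_left q w) continuous_const)

theorem mem_eigenspace_compactPart_one_iff (q : LInftyOn Ω) (u : H0s n s Ω) :
    u ∈ Module.End.eigenspace (compactPart s q : H0s n s Ω →ₗ[ℝ] H0s n s Ω) 1 ↔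
      (u : Hs n s) ∈ homSolutions s q := by
  rw [Module.End.mem_eigenspace_iff, one_smul]
  constructor
  · intro h
    refine ⟨u.2, solves_zero_iff.2 fun w hw => ?_⟩
    have h1 := form_eq_inner_sub_compactPart q u ⟨w, hw⟩
    have h2 : u - compactPart s q u = 0 := sub_eq_zero.2 h.symm
    rw [h1, h2]
    exact inner_zero_left (E := H0s n s Ω) _
  · intro h
    have h1 := form_eq_inner_sub_compactPart q u (u - compactPart s q u)
    rw [solves_zero_iff.1 h.2 _ (Subtype.prop _)] at h1
    exact (sub_eq_zero.1 ((inner_self_eq_zero (𝕜 := ℝ) (E := H0s n s Ω)).1 h1.symm)).symm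

theorem trace_eq_trace_iff {u v : Hs n s} : trace Ω u = trace Ω v ↔ u - v ∈ H0s n s Ω :=
  Submodule.Quotient.eq (H0s n s Ω)

theorem trace_surjective : Function.Surjective (trace Ω : Hs n s → TraceSpace n s Ω) :=
  (H0s n s Ω).mkQ_surjective

theorem isQuotientMap_trace : Topology.IsQuotientMap (trace Ω : Hs n s → TraceSpace n s Ω) :=
  isQuotientMap_quotient_mk'

theorem IsDirichletSolution.eq {q : LInftyOn Ω} {F : TraceSpace n s Ω} {u v : Hs n s}
    (hu : IsDirichletSolution q F u) (hv : IsDirichletSolution q F v) : u = v := by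
  have h1 : u - v ∈ homSolutions s q := by
    refine ⟨trace_eq_trace_iff.1 (hu.2.2.trans hv.2.2.symm), solves_zero_iff.2 fun w hw => ?_⟩
    rw [form_sub_left, solves_zero_iff.1 hu.2.1 w hw, solves_zero_iff.1 hv.2.1 w hw, sub_zero]
  exact sub_eq_zero.1 ((inner_self_eq_zero (𝕜 := ℝ) (E := Hs n s)).1
    (Submodule.inner_right_of_mem_orthogonal h1 (Submodule.sub_mem _ hu.1 hv.1)))

/-- Any extension `v` of `F` is corrected by some `x ∈ H0s` with `B_q(x, ·) = B_q(v, ·)` on `H0s`.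
Removing the `N_q` component afterwards changes neither the equation nor the trace. -/
theorem exists_isDirichletSolution (hs : 0 < s) (hΩ : MeasurableSet Ω)
    (hΩb : Bornology.IsBounded Ω) (q : LInftyOn Ω) {F : TraceSpace n s Ω}
    (hF : F ∈ admissibleTraces s q) : ∃ u, IsDirichletSolution q F u := by
  obtain ⟨v, rfl⟩ := trace_surjective F
  let φ : StrongDual ℝ (H0s n s Ω) :=
    ((innerSL ℝ (halfFracLaplacian v)).comp halfFracLaplacian +
      (innerSL ℝ (mulOp q (restrictL2 Ω v))).comp (restrictL2 Ω)).comp (H0s n s Ω).subtypeL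
  have hφ : ∀ w : H0s n s Ω, φ w = form q v w := fun w => (form_eq_inner q v w).symm
  obtain ⟨x, hx⟩ : ∃ x : H0s n s Ω, ∀ w : H0s n s Ω, ⟪x - compactPart s q x, w⟫_ℝ = φ w := by
    apply exists_forall_inner_sub_apply_eq (H := H0s n s Ω)
    · exact isCompactOperator_compactPart hs hΩ hΩb q
    · exact isSymmetric_compactPart q
    · intro w hw
      rw [hφ]
      exact hF v rfl w ((mem_eigenspace_compactPart_one_iff q w).1 hw)
  have hsol : ∀ w ∈ H0s n s Ω, form q (v - (x : Hs n s)) w = 0 := by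
    intro w hw
    rw [form_sub_left, form_eq_inner_sub_compactPart q x ⟨w, hw⟩, hx, hφ, sub_self]
  have hc : CompleteSpace (homSolutions s q : Submodule ℝ (Hs n s)) :=
    (isClosed_homSolutions q).completeSpace_coe
  set N : Submodule ℝ (Hs n s) := homSolutions s q with hN
  have hp : N.starProjection (v - (x : Hs n s)) ∈ homSolutions s q := N.starProjection_apply_mem _
  refine ⟨v - (x : Hs n s) - N.starProjection (v - (x : Hs n s)),
    N.sub_starProjection_mem_orthogonal _,
    solves_zero_iff.2 fun w hw => ?_, ?_⟩
  · rw [form_sub_left, hsol w hw, solves_zero_iff.1 hp.2 w hw, sub_zero]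
  · rw [trace_eq_trace_iff]
    have : v - (x : Hs n s) - N.starProjection (v - (x : Hs n s)) - v =
        -(x : Hs n s) - N.starProjection (v - (x : Hs n s)) := by
      abel
    rw [this]
    exact Submodule.sub_mem _ (Submodule.neg_mem _ x.2) hp.1

/-- The preimage under the quotient map is an intersection of kernels of continuous functionals. -/
theorem isClosed_admissibleTraces (q : LInftyOn Ω) :
    IsClosed (admissibleTraces s q : Set (TraceSpace n s Ω)) := by
  rw [← isQuotientMap_trace.isClosed_preimage]
  have h : trace Ω ⁻¹' (admissibleTraces s q : Set (TraceSpace n s Ω)) =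
      ⋂ w ∈ homSolutions (n := n) s q, {u : Hs n s | form q u w = 0} := by
    ext u
    simp only [Set.mem_preimage, Set.mem_iInter]
    constructor
    · intro h w hw
      exact h u rfl w hw
    · intro h v hv w hw
      have h1 := form_sub_left q v u w
      rw [form_comm, solves_zero_iff.1 hw.2 _ (trace_eq_trace_iff.1 hv)] at h1
      have h2 : form q u w = 0 := h w hw
      linarith
  rw [h]
  exact isClosed_biInter fun w _ => isClosed_eq (continuous_form_left q w) continuous_const

/-- The space of the solutions of `(-Δ)^s u + q u = 0` in `Ω` that are orthogonal to `N_q`. -/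
def solutionSpace (s : ℝ) (q : LInftyOn Ω) : Submodule ℝ (Hs n s) where
  carrier := {u | u ∈ HsPerp s q ∧ Solves q 0 u}
  add_mem' {u v} hu hv := by
    refine ⟨add_mem hu.1 hv.1, solves_zero_iff.2 fun w hw => ?_⟩
    have h := form_sub_left q (u + v) v w
    rw [add_sub_cancel_right, solves_zero_iff.1 hu.2 w hw, solves_zero_iff.1 hv.2 w hw] at h
    linarith
  zero_mem' := ⟨zero_mem _, (zero_mem (homSolutions s q)).2⟩
  smul_mem' c u hu := by
    refine ⟨Submodule.smul_mem _ c hu.1, solves_zero_iff.2 fun w hw => ?_⟩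
    have h := solves_zero_iff.1 hu.2 w hw
    rw [form_eq_inner] at h ⊢
    simp only [map_smul, real_inner_smul_left]
    rw [← mul_add, h, mul_zero]

theorem isClosed_solutionSpace (q : LInftyOn Ω) :
    IsClosed (solutionSpace s q : Set (Hs n s)) := by
  have h : (solutionSpace s q : Set (Hs n s)) =
      (HsPerp s q : Set (Hs n s)) ∩ ⋂ w ∈ H0s n s Ω, {u | form q u w = 0} := by
    ext u
    simp only [Set.mem_inter_iff, Set.mem_iInter]
    exact and_congr_right fun _ => solves_zero_iff
  rw [h]
  exact (Submodule.isClosed_orthogonal _).inter (isClosed_biInter fun w _ =>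
    isClosed_eq (continuous_form_left q w) continuous_const)

theorem trace_mem_admissibleTraces {q : LInftyOn Ω} {u : Hs n s} (hu : Solves q 0 u) :
    trace Ω u ∈ admissibleTraces s q := by
  intro v hv w hw
  have h1 := form_sub_left q v u w
  rw [form_comm q (v - u), solves_zero_iff.1 hw.2 _ (trace_eq_trace_iff.1 hv),
    solves_zero_iff.1 hu w hw.1] at h1
  linarith

/-- The Dirichlet problem has a bounded solution operator. -/
theorem exists_solutionOperator (hs : 0 < s) (hΩ : MeasurableSet Ω)
    (hΩb : Bornology.IsBounded Ω) (q : LInftyOn Ω) :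
    ∃ R : admissibleTraces (n := n) s q →L[ℝ] Hs n s,
      ∀ F : admissibleTraces (n := n) s q, IsDirichletSolution q (F : TraceSpace n s Ω) (R F) := by
  let A : Hs n s →L[ℝ] TraceSpace n s Ω := ⟨trace Ω, isQuotientMap_trace.continuous⟩
  have hA : Set.BijOn A (solutionSpace (n := n) s q) (admissibleTraces (n := n) s q) := by
    refine ⟨fun u hu => trace_mem_admissibleTraces hu.2,
      fun u hu v hv huv => IsDirichletSolution.eq ⟨hu.1, hu.2, huv⟩ ⟨hv.1, hv.2, rfl⟩,
      fun F hF => ?_⟩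
    obtain ⟨u, hu⟩ := exists_isDirichletSolution hs hΩ hΩb q hF
    exact ⟨u, ⟨hu.1, hu.2.1⟩, hu.2.2⟩
  -- The open mapping theorem gives boundedness without an a priori estimate.
  obtain ⟨R, hR⟩ := exists_continuousLinearMap_rightInverse A (isClosed_solutionSpace q)
    (isClosed_admissibleTraces q) hA
  exact ⟨R, fun F => ⟨(hR F).1.1, (hR F).1.2, (hR F).2⟩⟩

/-! ### Energy form of the Dirichlet-to-Neumann operator and monotonicity. -/

theorem neumannTrace_apply_self {q : LInftyOn Ω} {F : TraceSpace n s Ω} {u : Hs n s}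
    (hu : Solves q 0 u) (hF : trace Ω u = F) :
    neumannTrace u (-mulOp q (restrictL2 Ω u)) hu.fracLaplacian_eq F = form q u u := by
  rw [← hF, neumannTrace_trace, integral_eq_inner, form_eq_inner, inner_neg_left,
    sub_neg_eq_add, L2.inner_def (halfFracLaplacian u)]
  congr 1

theorem IsDirichletSolution.dtn_apply_self {q : LInftyOn Ω} {F : admissibleTraces (n := n) s q}
    {u : Hs n s} (hu : IsDirichletSolution q (F : TraceSpace n s Ω) u) :
    dtn s q F (F : TraceSpace n s Ω) = form q u u := by
  have h : ∃ u : Hs n s, IsDirichletSolution q (F : TraceSpace n s Ω) u := ⟨u, hu⟩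
  have hu' : h.choose = u := h.choose_spec.eq hu
  rw [dtn, dif_pos h]
  exact (neumannTrace_apply_self h.choose_spec.2.1 h.choose_spec.2.2).trans (by rw [hu'])

theorem integral_sub_mul_sq_eq_form_sub_form (q₁ q₂ : LInftyOn Ω) (u : Hs n s) :
    ∫ x in Ω, (q₁ x - q₂ x) * |toL2 u x| ^ 2 = form q₁ u u - form q₂ u u := by
  rw [form_eq_inner, form_eq_inner, add_sub_add_left_eq_sub, ← inner_sub_left, L2.inner_def]
  refine integral_congr_ae ?_
  filter_upwards [Lp.coeFn_sub (mulOp q₁ (restrictL2 Ω u)) (mulOp q₂ (restrictL2 Ω u)),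
    mulOp_ae q₁ (restrictL2 Ω u), mulOp_ae q₂ (restrictL2 Ω u), restrictL2_ae (Ω := Ω) u]
    with x h1 h2 h3 h4
  rw [h1, Pi.sub_apply, h2, h3, h4, real_inner_mul, sq_abs]
  ring

/-- The energy identity behind the monotonicity relation. -/
theorem form_sub_form_eq {q₁ q₂ : LInftyOn Ω} {F : TraceSpace n s Ω} {u₁ u₂ : Hs n s}
    (h₁ : IsDirichletSolution q₁ F u₁) (h₂ : IsDirichletSolution q₂ F u₂) :
    form q₁ u₁ u₁ - form q₂ u₂ u₂ =
      (form q₁ u₁ u₁ - form q₂ u₁ u₁) + form q₂ (u₁ - u₂) (u₁ - u₂) := by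
  have h := solves_zero_iff.1 h₂.2.1 (u₁ - u₂) (trace_eq_trace_iff.1 (h₁.2.2.trans h₂.2.2.symm))
  rw [form_sub_right] at h
  rw [form_sub_left, form_sub_right, form_sub_right, form_comm q₂ u₁ u₂]
  linarith

/-- A general closed `X` covers both orders of the intersection of the two trace spaces. Closedness
makes `X` a Hilbert space, as the double orthogonal complement argument requires. -/
theorem exists_submodule_forall_le_dtn_sub_dtn (hs : 0 < s) (hΩ : MeasurableSet Ω)
    (hΩb : Bornology.IsBounded Ω) (q₁ q₂ : LInftyOn Ω) (X : Submodule ℝ (TraceSpace n s Ω))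
    (hX : IsClosed (X : Set (TraceSpace n s Ω))) (h₁ : X ≤ admissibleTraces s q₁)
    (h₂ : X ≤ admissibleTraces s q₂) :
    ∃ V : Submodule ℝ X, Module.rank ℝ V ≤ numEigenvalues s q₂ ∧
      ∀ F ∈ Vᗮ, ∀ u₁ : Hs n s, IsDirichletSolution q₁ (F : TraceSpace n s Ω) u₁ →
        ∫ x in Ω, (q₁ x - q₂ x) * |toL2 u₁ x| ^ 2 ≤
          (dtn s q₁ ⟨F, h₁ F.2⟩ - dtn s q₂ ⟨F, h₂ F.2⟩) (F : TraceSpace n s Ω) := by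
  have hXc : CompleteSpace X := hX.completeSpace_coe
  obtain ⟨R₁, hR₁⟩ := exists_solutionOperator hs hΩ hΩb q₁
  obtain ⟨R₂, hR₂⟩ := exists_solutionOperator hs hΩ hΩb q₂
  let I₁ : X →L[ℝ] admissibleTraces (n := n) s q₁ := X.subtypeL.codRestrict _ fun F => h₁ F.2
  let I₂ : X →L[ℝ] admissibleTraces (n := n) s q₂ := X.subtypeL.codRestrict _ fun F => h₂ F.2
  -- `D F = u₁ - u₂` lies in `H0s` because the two solutions have the same trace.
  let D : X →L[ℝ] H0s n s Ω := (R₁.comp I₁ - R₂.comp I₂).codRestrict _ fun F =>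
    trace_eq_trace_iff.1 ((hR₁ (I₁ F)).2.2.trans (hR₂ (I₂ F)).2.2.symm)
  obtain ⟨V, hV, hV'⟩ : ∃ V : Submodule ℝ X, Module.rank ℝ V ≤ numEigenvalues s q₂ ∧
      ∀ F ∈ Vᗮ, 0 ≤ ⟪D F - compactPart s q₂ (D F), D F⟫_ℝ := by
    apply exists_submodule_forall_inner_sub_apply_nonneg (X := X) (H := H0s n s Ω)
    · exact isCompactOperator_compactPart hs hΩ hΩb q₂
    · exact isSymmetric_compactPart q₂
  refine ⟨V, hV, fun F hF u₁ hu₁ => ?_⟩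
  have hu : u₁ = R₁ (I₁ F) := hu₁.eq (hR₁ (I₁ F))
  have hnn : 0 ≤ form q₂ (u₁ - R₂ (I₂ F)) (u₁ - R₂ (I₂ F)) := by
    rw [hu]
    exact (hV' F hF).trans_eq (form_eq_inner_sub_compactPart q₂ (D F) (D F)).symm
  rw [sub_apply, hu₁.dtn_apply_self (F := ⟨F, h₁ F.2⟩),
    (hR₂ (I₂ F)).dtn_apply_self (F := ⟨F, h₂ F.2⟩), integral_sub_mul_sq_eq_form_sub_form,
    form_sub_form_eq hu₁ (hR₂ (I₂ F))]
  linarith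

end FracSchrodinger

end

theorem theorem3p3 {n : ℕ} (hn : 1 ≤ n) {s : ℝ} (hs0 : 0 < s) (hs1 : s < 1)
    {Ω : Set (FracSchrodinger.Eucl n)} (hΩ : IsOpen Ω) (hΩb : Bornology.IsBounded Ω)
    (q₁ q₂ : FracSchrodinger.LInftyOn Ω) :
    (∀ F ∈ FracSchrodinger.admissibleTraces s q₁,
      ∃! u, FracSchrodinger.IsDirichletSolution q₁ F u) ∧
    (∀ F ∈ FracSchrodinger.admissibleTraces s q₂,
      ∃! u, FracSchrodinger.IsDirichletSolution q₂ F u) ∧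
    (∃ V : Submodule ℝ
        ↥(FracSchrodinger.admissibleTraces s q₁ ⊓ FracSchrodinger.admissibleTraces s q₂),
      Module.rank ℝ V ≤ FracSchrodinger.numEigenvalues s q₂ ∧
      ∀ F : ↥(FracSchrodinger.admissibleTraces s q₁ ⊓ FracSchrodinger.admissibleTraces s q₂),
        F ∈ Vᗮ → ∀ u₁ : FracSchrodinger.Hs n s,
        FracSchrodinger.IsDirichletSolution q₁ (F : FracSchrodinger.TraceSpace n s Ω) u₁ →
        ∫ x in Ω, (q₁ x - q₂ x) * |FracSchrodinger.toL2 u₁ x| ^ 2 ≤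
          (FracSchrodinger.dtn s q₁ ⟨F, F.2.1⟩ - FracSchrodinger.dtn s q₂ ⟨F, F.2.2⟩)
            (F : FracSchrodinger.TraceSpace n s Ω)) ∧
    (q₂ ≤ᵐ[MeasureTheory.volume.restrict Ω] q₁ →
      FracSchrodinger.LoewnerLE (H := FracSchrodinger.TraceSpace n s Ω)
        (FracSchrodinger.numEigenvalues s q₂)
        (FracSchrodinger.dtn s q₂) (FracSchrodinger.dtn s q₁)) := by
  open FracSchrodinger in
  have hΩm := hΩ.measurableSet
  have hex : ∀ q : LInftyOn Ω, ∀ F ∈ admissibleTraces s q, ∃! u, IsDirichletSolution q F u := by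
    intro q F hF
    obtain ⟨u, hu⟩ := exists_isDirichletSolution hs0 hΩm hΩb q hF
    exact ⟨u, hu, fun v hv => hv.eq hu⟩
  have hcl : ∀ q q' : LInftyOn Ω, IsClosed
      ((admissibleTraces s q ⊓ admissibleTraces s q' : Submodule ℝ (TraceSpace n s Ω)) :
        Set (TraceSpace n s Ω)) := fun q q' =>
    (isClosed_admissibleTraces q).inter (isClosed_admissibleTraces q')
  refine ⟨hex q₁, hex q₂, ?_, fun hq => ?_⟩
  · exact exists_submodule_forall_le_dtn_sub_dtn hs0 hΩm hΩb q₁ q₂ _ (hcl q₁ q₂) inf_le_left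
      inf_le_right
  -- `LoewnerLE` takes the smaller operator first, so the intersection appears here with `q₂` before
  -- `q₁`.
  · obtain ⟨W, hW, h⟩ := exists_submodule_forall_le_dtn_sub_dtn hs0 hΩm hΩb q₁ q₂ _ (hcl q₂ q₁)
      inf_le_right inf_le_left
    refine ⟨W, hW, fun F hF => ?_⟩
    obtain ⟨u, hu⟩ := exists_isDirichletSolution hs0 hΩm hΩb q₁ F.2.2
    refine le_trans (integral_nonneg_of_ae ?_) (h F hF u hu)
    filter_upwards [hq] with x hx
    exact mul_nonneg (sub_nonneg.2 hx) (by positivity)
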